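/- **Theorem 1.4.** There exist absolute constants $C, N \ge 0$, $N\in\mathbb N$, with the following property. Let $\Omega\subset\mathbb C$ be a bounded, simply connected domain, let $\psi:\mathbb D\to\Omega$ be a conformal map of the unit disc $\mathbb D$ onto $\Omega$, and let $dA$ be Lebesgue area measure. For an arc $I\subset\mathbb T$ (possibly all of $\mathbb T$) let $\ell(I)$ be its arclength, normalized so that $\ell(\mathbb T)=1$, and let $e^{i\theta_0}$ be its center; let $$Q_I=\{re^{i\theta}\in\mathbb D:\ 1-r\le \ell(I),\ |\theta-\theta_0|\le \pi\,\ell(I)\}$$ be its Carleson box. A weight is a locally integrable, almost everywhere positive function. For weights $\sigma$ on $\Omega$ and $v$ on $\mathbb D$ put $$[\sigma]_{\mathrm B_1(\Omega)}=\sup_I\Big(\frac{1}{|\psi(Q_I)|}\int_{\psi(Q_I)}\sigma\,dA\Big)\|\sigma^{-1}\|_{L^\infty(\psi(Q_I))},\qquad [v]_{\mathrm B_1(\mathbb D)}=\sup_I\Big(\frac{1}{|Q_I|}\int_{Q_I}v\,dA\Big)\|v^{-1}\|_{L^\infty(Q_I)}.$$ Let $K_\Omega$ be the Bergman kernel of $\Omega$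 (the reproducing kernel of the space of holomorphic functions in $L^2(\Omega,dA)$) and let $$\Pi_\Omega f(z)=\int_\Omega K_\Omega(z,w)f(w)\,dA(w),\qquad z\in\Omega,$$ be the Bergman projection, which on $L^2(\Omega,dA)$ is the orthogonal projection onto the subspace of holomorphic functions. If $[|\psi'|^2]_{\mathrm B_1(\mathbb D)}<\infty$ and $\sigma$ is a weight on $\Omega$ with $[\sigma]_{\mathrm B_1(\Omega)}<\infty$, then for every $f\in L^1(\Omega,\sigma)$ the integral defining $\Pi_\Omega f(z)$ converges absolutely for every $z\in\Omega$, $\Pi_\Omega f$ is measurable, and $$\sup_{t>0}\ t\int_{\{z\in\Omega:\ |\Pi_\Omega f(z)|>t\}}\sigma\,dA\ \le\ C\,[|\psi'|^2]_{\mathrm B_1(\mathbb D)}^{N}\,[\sigma]_{\mathrm B_1(\Omega)}^{3}\int_\Omega|f|\,\sigma\,dA .$$ That is, $\Pi_\Omega$ maps $L^1(\Omega,\sigma)$ boundedly into $L^{1,\infty}(\Omega,\sigma)$, with norm $\lesssim[\sigma]_{\mathrm B_1(\Omega)}^3$, the implicit constant depending polynomially on $[|\psi'|^2]_{\mathrm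 B_1(\mathbb D)}$ and on nothing else. -/

import Mathlib

open MeasureTheory Metric Set Filter Topology
open scoped ENNReal NNReal

noncomputable section

/-! ### Bergman spaces and the Bergman projection -/

/-- Interior estimate: the value of a holomorphic function is controlled by its `L²` norm. -/
theorem holomorphic_enorm_sq_le (Ω : TopologicalSpace.Opens ℂ) {F : ℂ → ℂ}
    (hF : DifferentiableOn ℂ F Ω) {z : ℂ} {r : ℝ} (hr : 0 < r)
    (hz : closedBall z r ⊆ (Ω : Set ℂ)) :
    ENNReal.ofReal (r / 2) * (ENNReal.ofReal (r / 2) * (ENNReal.ofReal (2 * Real.pi) * ‖F z‖ₑ ^ 2))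
      ≤ ∫⁻ w in (Ω : Set ℂ), ‖F w‖ₑ ^ 2 := by
  classical
  set G : ℂ → ℂ := (Ω : Set ℂ).piecewise F 0 with hG
  have hGm : Measurable G :=
    hF.continuousOn.measurable_piecewise continuousOn_const Ω.isOpen.measurableSet
  have hGΩ : ∀ w ∈ (Ω : Set ℂ), G w = F w := fun w hw => Set.piecewise_eq_of_mem _ _ _ hw
  have h1 : ∫⁻ w in (Ω : Set ℂ), ‖F w‖ₑ ^ 2 = ∫⁻ w, ‖G w‖ₑ ^ 2 := by
    rw [← lintegral_indicator Ω.isOpen.measurableSet]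
    refine lintegral_congr fun w => ?_
    by_cases hw : w ∈ (Ω : Set ℂ)
    · rw [Set.indicator_of_mem hw, hGΩ w hw]
    · rw [Set.indicator_of_notMem hw, hG, Set.piecewise_eq_of_notMem _ _ _ hw]; simp
  rw [h1, ← lintegral_add_left_eq_self (fun w => ‖G w‖ₑ ^ 2) z,
    ← Complex.lintegral_comp_polarCoord_symm, polarCoord_target]
  have hsub : Ioo (r / 2) r ×ˢ Ioo (-Real.pi) Real.pi ⊆
      Ioi (0 : ℝ) ×ˢ Ioo (-Real.pi) Real.pi :=
    Set.prod_mono (fun x hx => lt_trans (by linarith) hx.1) le_rfl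
  refine le_trans ?_ (lintegral_mono_set hsub)
  have hmeas : Measurable fun p : ℝ × ℝ =>
      ENNReal.ofReal p.1 • ‖G (z + Complex.polarCoord.symm p)‖ₑ ^ 2 := by
    simp only [Complex.polarCoord_symm_apply, smul_eq_mul]
    refine Measurable.mul (ENNReal.measurable_ofReal.comp measurable_fst) ?_
    refine Measurable.pow_const (Measurable.enorm (hGm.comp ?_)) 2
    fun_prop
  rw [Measure.volume_eq_prod, setLIntegral_prod _ hmeas.aemeasurable]
  have hcirc : ∀ ρ ∈ Ioo (r / 2) r, ENNReal.ofReal (2 * Real.pi) * ‖F z‖ₑ ^ 2 ≤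
      ∫⁻ θ in Ioo (-Real.pi) Real.pi, ‖G (z + Complex.polarCoord.symm (ρ, θ))‖ₑ ^ 2 := by
    intro ρ hρ
    have hρ0 : 0 < ρ := lt_trans (by linarith) hρ.1
    have hsubρ : closedBall z |ρ| ⊆ (Ω : Set ℂ) := by
      rw [abs_of_pos hρ0]; exact (closedBall_subset_closedBall hρ.2.le).trans hz
    have hd : DiffContOnCl ℂ (fun w => F w ^ 2) (ball z |ρ|) := by
      refine DifferentiableOn.diffContOnCl ?_
      exact (hF.pow 2).mono ((closure_ball_subset_closedBall).trans hsubρ)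
    have hav := hd.circleAverage
    rw [Real.circleAverage_eq_integral_add (-Real.pi),
      intervalIntegral.integral_comp_add_right (fun θ => F (circleMap z ρ θ) ^ 2)] at hav
    have hav' : (2 * Real.pi) • (F z ^ 2) =
        ∫ θ in (-Real.pi)..Real.pi, F (circleMap z ρ θ) ^ 2 := by
      rw [← hav, smul_smul, mul_inv_cancel₀ (by positivity), one_smul]
      congr 1 <;> ring
    have hn : ‖(2 * Real.pi) • (F z ^ 2)‖ₑ = ENNReal.ofReal (2 * Real.pi) * ‖F z‖ₑ ^ 2 := by
      rw [enorm_smul, enorm_pow, Real.enorm_eq_ofReal (by positivity)]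
    rw [← hn, hav', intervalIntegral.integral_of_le (by linarith [Real.pi_pos]),
      integral_Ioc_eq_integral_Ioo]
    refine (enorm_integral_le_lintegral_enorm _).trans (le_of_eq ?_)
    refine lintegral_congr fun θ => ?_
    have hc : z + Complex.polarCoord.symm (ρ, θ) = circleMap z ρ θ := by
      rw [circleMap, Complex.exp_mul_I]; simp
    have hm : circleMap z ρ θ ∈ (Ω : Set ℂ) :=
      hsubρ (sphere_subset_closedBall (circleMap_mem_sphere' z ρ θ))
    rw [hc, hGΩ _ hm, enorm_pow]
  have hin : ∀ ρ ∈ Ioo (r / 2) r,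
      ENNReal.ofReal (r / 2) * (ENNReal.ofReal (2 * Real.pi) * ‖F z‖ₑ ^ 2) ≤
      ∫⁻ θ in Ioo (-Real.pi) Real.pi,
        ENNReal.ofReal ρ • ‖G (z + Complex.polarCoord.symm (ρ, θ))‖ₑ ^ 2 := by
    intro ρ hρ
    simp only [smul_eq_mul]
    rw [lintegral_const_mul' _ _ ENNReal.ofReal_ne_top]
    exact mul_le_mul' (ENNReal.ofReal_le_ofReal hρ.1.le) (hcirc ρ hρ)
  refine le_trans ?_ (setLIntegral_mono' measurableSet_Ioo hin)
  rw [setLIntegral_const, Real.volume_Ioo, mul_comm (ENNReal.ofReal (r / 2))]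
  rw [show r - r / 2 = r / 2 by ring]

/-- `HolomorphicL2 Ω F`: the function `F` is holomorphic on `Ω` and square integrable over `Ω`. -/
def HolomorphicL2 (Ω : TopologicalSpace.Opens ℂ) (F : ℂ → ℂ) : Prop :=
  DifferentiableOn ℂ F Ω ∧ MemLp F 2 (volume.restrict (Ω : Set ℂ))

theorem lintegral_enorm_sq_eq_eLpNorm_sq (μ : Measure ℂ) (F : ℂ → ℂ) :
    ∫⁻ w, ‖F w‖ₑ ^ 2 ∂μ = eLpNorm F 2 μ ^ 2 := by
  rw [eLpNorm_eq_lintegral_rpow_enorm_toReal two_ne_zero ENNReal.ofNat_ne_top, ← ENNReal.rpow_natCast,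
    ← ENNReal.rpow_mul]
  simp

theorem holomorphic_norm_le (Ω : TopologicalSpace.Opens ℂ) {r : ℝ} (hr : 0 < r) :
    ∃ C : ℝ, ∀ z : ℂ, closedBall z r ⊆ (Ω : Set ℂ) → ∀ F : ℂ → ℂ, HolomorphicL2 Ω F →
      ‖F z‖ ≤ C * (eLpNorm F 2 (volume.restrict (Ω : Set ℂ))).toReal := by
  have hc : 0 < r / 2 * (r / 2 * (2 * Real.pi)) := by positivity
  refine ⟨(Real.sqrt (r / 2 * (r / 2 * (2 * Real.pi))))⁻¹, fun z hz F hF => ?_⟩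
  have h := holomorphic_enorm_sq_le Ω hF.1 hr hz
  rw [lintegral_enorm_sq_eq_eLpNorm_sq] at h
  have h' := ENNReal.toReal_mono (ENNReal.pow_ne_top hF.2.eLpNorm_ne_top) h
  simp only [ENNReal.toReal_mul, ENNReal.toReal_pow, toReal_enorm] at h'
  rw [ENNReal.toReal_ofReal (by positivity), ENNReal.toReal_ofReal (by positivity)] at h'
  rw [inv_mul_eq_div, le_div_iff₀ (Real.sqrt_pos.2 hc)]
  refine le_of_sq_le_sq ?_ ENNReal.toReal_nonneg
  rw [mul_pow, Real.sq_sqrt hc.le]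
  linarith

/-- The Bergman space `A²(Ω)`: the classes in `L²(Ω)` that have a holomorphic representative. -/
def bergmanSpace (Ω : TopologicalSpace.Opens ℂ) :
    Submodule ℂ (Lp ℂ 2 (volume.restrict (Ω : Set ℂ))) where
  carrier := {f | ∃ F : ℂ → ℂ, DifferentiableOn ℂ F Ω ∧ f =ᵐ[volume.restrict (Ω : Set ℂ)] F}
  add_mem' := by
    rintro f g ⟨F, hF, hf⟩ ⟨G, hG, hg⟩
    exact ⟨F + G, hF.add hG, (Lp.coeFn_add f g).trans (hf.add hg)⟩
  zero_mem' := ⟨0, differentiableOn_const 0, Lp.coeFn_zero _ _ _⟩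
  smul_mem' := by
    rintro c f ⟨F, hF, hf⟩
    exact ⟨c • F, hF.const_smul c, (Lp.coeFn_smul c f).trans (hf.const_smul c)⟩

/-- The holomorphic representative of an element of the Bergman space. -/
def holoRep {Ω : TopologicalSpace.Opens ℂ} (f : bergmanSpace Ω) : ℂ → ℂ := f.2.choose

theorem holoRep_differentiableOn {Ω : TopologicalSpace.Opens ℂ} (f : bergmanSpace Ω) :
    DifferentiableOn ℂ (holoRep f) Ω := f.2.choose_spec.1

theorem holoRep_ae {Ω : TopologicalSpace.Opens ℂ} (f : bergmanSpace Ω) :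
    (f : Lp ℂ 2 (volume.restrict (Ω : Set ℂ))) =ᵐ[volume.restrict (Ω : Set ℂ)] holoRep f :=
  f.2.choose_spec.2

theorem holoRep_holomorphicL2 {Ω : TopologicalSpace.Opens ℂ} (f : bergmanSpace Ω) :
    HolomorphicL2 Ω (holoRep f) :=
  ⟨holoRep_differentiableOn f, (memLp_congr_ae (holoRep_ae f)).1 (Lp.memLp _)⟩

theorem holoRep_eLpNorm {Ω : TopologicalSpace.Opens ℂ} (f : bergmanSpace Ω) :
    (eLpNorm (holoRep f) 2 (volume.restrict (Ω : Set ℂ))).toReal = ‖f‖ := by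
  rw [← eLpNorm_congr_ae (holoRep_ae f)]; rfl

/-- Two holomorphic functions that agree almost everywhere on `Ω` agree on `Ω`. -/
theorem holomorphic_eq_of_ae {Ω : TopologicalSpace.Opens ℂ} {F G : ℂ → ℂ}
    (hF : DifferentiableOn ℂ F Ω) (hG : DifferentiableOn ℂ G Ω)
    (h : F =ᵐ[volume.restrict (Ω : Set ℂ)] G) : EqOn F G Ω := by
  intro z hz
  have h0 : (F - G) =ᵐ[volume.restrict (Ω : Set ℂ)] (0 : ℂ → ℂ) := by
    filter_upwards [h] with w hw using by simp [hw]
  obtain ⟨r, hr, hzr⟩ := nhds_basis_closedBall.mem_iff.1 (Ω.isOpen.mem_nhds hz)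
  obtain ⟨C, hC⟩ := holomorphic_norm_le Ω hr
  have := hC z hzr (F - G) ⟨hF.sub hG, (memLp_congr_ae h0).2 MemLp.zero⟩
  rw [eLpNorm_congr_ae h0] at this
  simpa [sub_eq_zero] using this

theorem holoRep_add {Ω : TopologicalSpace.Opens ℂ} (f g : bergmanSpace Ω) :
    EqOn (holoRep (f + g)) (holoRep f + holoRep g) Ω := by
  refine holomorphic_eq_of_ae (holoRep_differentiableOn _)
    ((holoRep_differentiableOn _).add (holoRep_differentiableOn _)) ?_
  exact (holoRep_ae (f + g)).symm.trans ((Lp.coeFn_add _ _).trans ((holoRep_ae f).add (holoRep_ae g)))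

theorem holoRep_smul {Ω : TopologicalSpace.Opens ℂ} (c : ℂ) (f : bergmanSpace Ω) :
    EqOn (holoRep (c • f)) (c • holoRep f) Ω := by
  refine holomorphic_eq_of_ae (holoRep_differentiableOn _)
    ((holoRep_differentiableOn _).const_smul c) ?_
  exact (holoRep_ae (c • f)).symm.trans ((Lp.coeFn_smul _ _).trans ((holoRep_ae f).const_smul c))

theorem holoRep_sub {Ω : TopologicalSpace.Opens ℂ} (f g : bergmanSpace Ω) :
    EqOn (holoRep (f - g)) (holoRep f - holoRep g) Ω := by
  refine holomorphic_eq_of_ae (holoRep_differentiableOn _)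
    ((holoRep_differentiableOn _).sub (holoRep_differentiableOn _)) ?_
  exact (holoRep_ae (f - g)).symm.trans ((Lp.coeFn_sub _ _).trans ((holoRep_ae f).sub (holoRep_ae g)))

/-- The Bergman space is closed in `L²(Ω)`. -/
theorem bergmanSpace_isClosed (Ω : TopologicalSpace.Opens ℂ) :
    IsClosed (bergmanSpace Ω : Set (Lp ℂ 2 (volume.restrict (Ω : Set ℂ)))) := by
  refine isSeqClosed_iff_isClosed.1 ?_
  intro f g hf hfg
  let f' : ℕ → bergmanSpace Ω := fun n => ⟨f n, hf n⟩
  have hcau : ∀ ε > 0, ∃ N, ∀ m ≥ N, ∀ n ≥ N, ‖f' m - f' n‖ < ε := by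
    intro ε hε
    obtain ⟨N, hN⟩ := Metric.cauchySeq_iff.1 hfg.cauchySeq ε hε
    refine ⟨N, fun m hm n hn => ?_⟩
    have := hN m hm n hn
    rw [dist_eq_norm] at this
    exact this
  have hucs : ∀ (r : ℝ) (_ : 0 < r) (s : Set ℂ), (∀ z ∈ s, closedBall z r ⊆ (Ω : Set ℂ)) →
      UniformCauchySeqOn (fun n => holoRep (f' n)) atTop s := by
    intro r hr s hs
    obtain ⟨C, hC⟩ := holomorphic_norm_le Ω hr
    rw [Metric.uniformCauchySeqOn_iff]
    intro ε hε
    obtain ⟨N, hN⟩ := hcau (ε / (|C| + 1)) (by positivity)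
    refine ⟨N, fun m hm n hn z hz => ?_⟩
    have hzΩ : z ∈ (Ω : Set ℂ) := hs z hz (mem_closedBall_self hr.le)
    have h1 := hC z (hs z hz) _ (holoRep_holomorphicL2 (f' m - f' n))
    rw [holoRep_eLpNorm, holoRep_sub _ _ hzΩ] at h1
    rw [dist_eq_norm]
    have h2 := hN m hm n hn
    rw [lt_div_iff₀ (by positivity)] at h2
    have h3 : C * ‖f' m - f' n‖ ≤ |C| * ‖f' m - f' n‖ :=
      mul_le_mul_of_nonneg_right (le_abs_self C) (norm_nonneg _)
    have h4 := norm_nonneg (f' m - f' n)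
    calc ‖holoRep (f' m) z - holoRep (f' n) z‖ ≤ C * ‖f' m - f' n‖ := h1
      _ < ε := by nlinarith
  have hlim : ∀ z : ℂ, ∃ y, z ∈ (Ω : Set ℂ) →
      Tendsto (fun n => holoRep (f' n) z) atTop (𝓝 y) := by
    intro z
    by_cases hz : z ∈ (Ω : Set ℂ)
    · obtain ⟨r, hr, hzr⟩ := nhds_basis_closedBall.mem_iff.1 (Ω.isOpen.mem_nhds hz)
      have hc : CauchySeq fun n => holoRep (f' n) z :=
        (hucs r hr {z} (by simpa using hzr)).cauchySeq (mem_singleton z)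
      obtain ⟨y, hy⟩ := cauchySeq_tendsto_of_complete hc
      exact ⟨y, fun _ => hy⟩
    · exact ⟨0, fun h => absurd h hz⟩
  choose G hG using hlim
  have hlu : TendstoLocallyUniformlyOn (fun n => holoRep (f' n)) G atTop (Ω : Set ℂ) := by
    refine tendstoLocallyUniformlyOn_of_forall_exists_nhds fun z hz => ?_
    obtain ⟨r, hr, hzr⟩ := nhds_basis_closedBall.mem_iff.1 (Ω.isOpen.mem_nhds hz)
    refine ⟨ball z (r / 2), mem_nhdsWithin_of_mem_nhds (ball_mem_nhds z (by positivity)), ?_⟩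
    have hs : ∀ w ∈ ball z (r / 2), closedBall w (r / 2) ⊆ (Ω : Set ℂ) := by
      intro w hw
      refine (closedBall_subset_closedBall' ?_).trans hzr
      rw [mem_ball] at hw; linarith
    exact (hucs (r / 2) (by positivity) _ hs).tendstoUniformlyOn_of_tendsto
      fun w hw => hG w (hs w hw (mem_closedBall_self (by positivity)))
  have hGd : DifferentiableOn ℂ G Ω :=
    hlu.differentiableOn (Eventually.of_forall fun n => holoRep_differentiableOn (f' n)) Ω.isOpen
  refine ⟨G, hGd, ?_⟩
  obtain ⟨ns, hns, hae⟩ := (tendstoInMeasure_of_tendsto_Lp hfg).exists_seq_tendsto_ae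
  have hall : ∀ᵐ x ∂(volume.restrict (Ω : Set ℂ)), ∀ n, f n x = holoRep (f' n) x :=
    ae_all_iff.2 fun n => holoRep_ae (f' n)
  filter_upwards [hae, hall, ae_restrict_mem Ω.isOpen.measurableSet] with x hx hx' hxΩ
  refine tendsto_nhds_unique hx ?_
  simp only [hx']
  exact (hG x hxΩ).comp hns.tendsto_atTop

instance bergmanSpace_completeSpace (Ω : TopologicalSpace.Opens ℂ) :
    CompleteSpace (bergmanSpace Ω) :=
  (bergmanSpace_isClosed Ω).completeSpace_coe

/-- Evaluation at a point of `Ω`, as a continuous linear functional on the Bergman space. -/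
def bergmanEval (Ω : TopologicalSpace.Opens ℂ) (z : Ω) : bergmanSpace Ω →L[ℂ] ℂ :=
  LinearMap.mkContinuousOfExistsBound
    { toFun := fun f => holoRep f z
      map_add' := fun f g => holoRep_add f g z.2
      map_smul' := fun c f => holoRep_smul c f z.2 }
    (by
      obtain ⟨r, hr, hzr⟩ := nhds_basis_closedBall.mem_iff.1 (Ω.isOpen.mem_nhds z.2)
      obtain ⟨C, hC⟩ := holomorphic_norm_le Ω hr
      refine ⟨C, fun f => ?_⟩
      have := hC z hzr _ (holoRep_holomorphicL2 f)
      rwa [holoRep_eLpNorm] at this)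

open Classical in
/-- The Bergman kernel of `Ω` (with respect to Lebesgue measure): for `z ∈ Ω`, the conjugate of
`K(z, ·)` is the element of the Bergman space that represents evaluation at `z`. -/
def bergmanKernel (Ω : TopologicalSpace.Opens ℂ) (z w : ℂ) : ℂ :=
  if h : z ∈ Ω then
    (starRingEnd ℂ) (holoRep ((InnerProductSpace.toDual ℂ (bergmanSpace Ω)).symm
      (bergmanEval Ω ⟨z, h⟩)) w)
  else 0

/-- The Bergman projection `Π_Ω f (z) = ∫_Ω K(z, w) f(w) dA(w)`. On `L²(Ω)` it is the orthogonal
projection onto the Bergman space, see `bergmanProj_eq_starProjection`. -/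
def bergmanProj (Ω : TopologicalSpace.Opens ℂ) (f : ℂ → ℂ) (z : ℂ) : ℂ :=
  ∫ w in (Ω : Set ℂ), bergmanKernel Ω z w * f w

/-- On `L²(Ω)` the Bergman projection is the orthogonal projection onto the Bergman space. -/
theorem bergmanProj_eq_starProjection (Ω : TopologicalSpace.Opens ℂ)
    (f : Lp ℂ 2 (volume.restrict (Ω : Set ℂ))) :
    bergmanProj Ω f =ᵐ[volume.restrict (Ω : Set ℂ)] (bergmanSpace Ω).starProjection f := by
  have key : EqOn (bergmanProj Ω f) (holoRep ((bergmanSpace Ω).orthogonalProjectionOnto f)) Ω := by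
    intro z hz
    set k := (InnerProductSpace.toDual ℂ (bergmanSpace Ω)).symm (bergmanEval Ω ⟨z, hz⟩) with hk
    have h1 : bergmanProj Ω f z = inner ℂ (k : Lp ℂ 2 (volume.restrict (Ω : Set ℂ))) f := by
      rw [L2.inner_def, bergmanProj]
      refine integral_congr_ae ?_
      filter_upwards [holoRep_ae k] with w hw
      have hz' : z ∈ Ω := hz
      rw [hw, bergmanKernel, dif_pos hz', RCLike.inner_apply, mul_comm]
    rw [h1, ← Submodule.inner_orthogonalProjectionOnto_eq_of_mem_left, hk,
      InnerProductSpace.toDual_symm_apply]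
    rfl
  have h2 := holoRep_ae ((bergmanSpace Ω).orthogonalProjectionOnto f)
  filter_upwards [h2, ae_restrict_mem Ω.isOpen.measurableSet] with x hx hxΩ
  rw [key hxΩ, ← hx]
  rfl

/-! ### Carleson boxes, weights and the `B₁` characteristic -/

/-- `IsConformalOnto ψ Ω`: the function `ψ` maps the unit disc conformally onto `Ω`. -/
structure IsConformalOnto (ψ : ℂ → ℂ) (Ω : TopologicalSpace.Opens ℂ) : Prop where
  differentiableOn : DifferentiableOn ℂ ψ (ball 0 1)
  injOn : InjOn ψ (ball 0 1)
  image_eq : ψ '' ball 0 1 = Ω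

/-- The Carleson box `Q_I` over the arc `I` of the unit circle with center `exp (i θ₀)` and
arclength `ℓ`, where arclength is normalized so that the whole circle has length `1`. -/
def carlesonBox (θ₀ ℓ : ℝ) : Set ℂ :=
  {z | ∃ r θ : ℝ, 0 ≤ r ∧ r < 1 ∧ 1 - r ≤ ℓ ∧ |θ - θ₀| ≤ Real.pi * ℓ ∧
    z = r * Complex.exp (θ * Complex.I)}

/-- A weight on `Ω`: a locally integrable, almost everywhere positive function. -/
structure IsWeightOn (Ω : TopologicalSpace.Opens ℂ) (σ : ℂ → ℝ) : Prop where
  locallyIntegrableOn : LocallyIntegrableOn σ (Ω : Set ℂ) volume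
  pos : ∀ᵐ z ∂(volume.restrict (Ω : Set ℂ)), 0 < σ z

/-- The average of `σ` over the set `E`. -/
def weightAverage (σ : ℂ → ℝ) (E : Set ℂ) : ℝ≥0∞ :=
  (∫⁻ z in E, ENNReal.ofReal (σ z)) / volume E

/-- The characteristic `sup_I ⟨σ⟩_{ψ(Q_I)} ‖σ⁻¹‖_{L^∞(ψ(Q_I))}`, the supremum being over all arcs
`I` of the unit circle. For `ψ` a conformal map onto `Ω` this is `[σ]_{B₁(Ω)}`; for `ψ = id` it is
the classical Békollè-Bonami characteristic `[σ]_{B₁(𝔻)}` on the unit disc. -/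
def b1Char (ψ : ℂ → ℂ) (σ : ℂ → ℝ) : ℝ≥0∞ :=
  ⨆ (θ₀ : ℝ) (ℓ : ℝ) (_ : 0 < ℓ ∧ ℓ ≤ 1),
    weightAverage σ (ψ '' carlesonBox θ₀ ℓ) *
      eLpNorm (fun z => (σ z)⁻¹) ∞ (volume.restrict (ψ '' carlesonBox θ₀ ℓ))

/-- The measure `σ dA` on `Ω`. -/
def weightMeasure (Ω : TopologicalSpace.Opens ℂ) (σ : ℂ → ℝ) : Measure ℂ :=
  (volume.restrict (Ω : Set ℂ)).withDensity fun z => ENNReal.ofReal (σ z)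

/-- The quasinorm of weak `L¹`: the supremum over `t > 0` of `t * μ {|F| > t}`. -/
def weakL1Norm (F : ℂ → ℂ) (μ : Measure ℂ) : ℝ≥0∞ :=
  ⨆ t : ℝ≥0, (t : ℝ≥0∞) * μ {z | (t : ℝ) < ‖F z‖}

end

/-! Write `U` for the `B₁` constant of |ψ'|², `B` for that of σ, and ν for the measure σ dA on Ω.
The plan is to dominate the Bergman projection by two positive dyadic operators and to prove a weak
type bound for operators of that kind.

The kernel has the closed form K(ψ z, ψ w) = (π ψ'(z) conj(ψ'(w)) (1 - z w̄)²)⁻¹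
(`IsConformalOnto.bergmanKernel_eq`). By the one-third trick any two points z, w of the disc share a
box Q, of side ℓ ≤ 6 |1 - z w̄|, in one of two dyadic grids (`exists_mem_gridBox`). Let D be the
essential supremum of |ψ'|⁻² over the Carleson hull Q* of Q. As (xy)⁻¹ ≤ max(x⁻², y⁻²), the kernel
is at most 12 ℓ⁻² D for almost all points. So |Π f| is at most the sum over both grids of the
operators Σ_Q 12 ℓ⁻² D (∫_{ψ(Q)} |f|) 1_{ψ(Q)}.

Let S be the essential supremum of σ⁻¹ over ψ(Q*). Since |ψ(Q*)| is the integral of |ψ'|² over Q*,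
the two `B₁` conditions chain together: ν(ψ(Q)) S D ≤ B |ψ(Q*)| D ≤ B U |Q*| ≤ 100 B U ℓ². This has
two consequences. The coefficient of Q times ν(ψ(Q)) is at most 1200 B U ∫_{ψ(Q)} |f| σ. Moreover,
if T is the top half of Q, then ℓ² ≤ 100 |T| ≤ 100 D S ν(ψ(T)), hence ν(ψ(Q)) ≤ K ν(ψ(T)) with K =
10⁴ B U. The sets ψ(T) are disjoint, so the boxes ψ(Q) form a sparse nested family for ν.

For a sparse nested family, `IsNestedFamily.measure_one_lt_tsum_le` gives weak type with constant 1
+ 4 K². It removes the set where the maximal function M exceeds 1, and on the remaining part E of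
the level set it compares the sum with the integral of M times the maximal function of 1_E. Since 1
≤ K, the total is of order K² B U, which yields the third power of both constants. -/

/-! ### Weak type estimate for sparse positive operators -/

section Sparse

variable {X ι : Type*} [MeasurableSpace X] [Countable ι]

/-- A family of measurable sets, graded by `gen`, that is nested like a dyadic grid. -/
structure IsNestedFamily (gen : ι → ℕ) (Q : ι → Set X) : Prop where
  measurableSet : ∀ i, MeasurableSet (Q i)
  subset : ∀ i j, gen i ≤ gen j → (Q i ∩ Q j).Nonempty → Q j ⊆ Q i
  disjoint : ∀ i j, gen i = gen j → i ≠ j → Disjoint (Q i) (Q j)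

/-- Weak type (1,1) of the dyadic maximal function: the maximal sets of the subfamily are disjoint
and cover the same union, so the hypothesis can be summed over them. -/
theorem IsNestedFamily.mul_measure_biUnion_le {gen : ι → ℕ} {Q : ι → Set X}
    (hQ : IsNestedFamily gen Q) {ν lam : Measure X} (S : Set ι) (c : ℝ≥0∞)
    (h : ∀ i ∈ S, c * ν (Q i) ≤ lam (Q i)) : c * ν (⋃ i ∈ S, Q i) ≤ lam univ := by
  set S' : Set ι := {i ∈ S | ∀ j ∈ S, gen j < gen i → ¬ (Q j ∩ Q i).Nonempty} with hS'
  have hU : (⋃ i ∈ S, Q i) ⊆ ⋃ i ∈ S', Q i := by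
    intro x hx
    have hne : ∃ n, ∃ i ∈ S, x ∈ Q i ∧ gen i = n := by
      simp only [mem_iUnion] at hx
      obtain ⟨i, hi, hxi⟩ := hx
      exact ⟨_, i, hi, hxi, rfl⟩
    classical
    obtain ⟨i, hi, hxi, hgi⟩ := Nat.find_spec hne
    simp only [mem_iUnion]
    refine ⟨i, ⟨hi, fun j hj hji hn => ?_⟩, hxi⟩
    -- `i` has least generation among the sets of `S` that contain `x`. An earlier `Q j` meeting `Q
    -- i` would contain it, hence contain `x`.
    exact Nat.find_min hne (hgi ▸ hji) ⟨j, hj, hQ.subset j i hji.le hn hxi, rfl⟩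
  have hd : S'.PairwiseDisjoint Q := by
    intro i hi j hj hij
    rcases lt_trichotomy (gen i) (gen j) with hg | hg | hg
    · exact Set.disjoint_iff_inter_eq_empty.2 (not_nonempty_iff_eq_empty.1 (hj.2 i hi.1 hg))
    · exact hQ.disjoint i j hg hij
    · exact (Set.disjoint_iff_inter_eq_empty.2
        (not_nonempty_iff_eq_empty.1 (hi.2 j hj.1 hg))).symm
  calc c * ν (⋃ i ∈ S, Q i) ≤ c * ν (⋃ i ∈ S', Q i) := by gcongr
    _ = ∑' i : S', c * ν (Q i) := by
      rw [measure_biUnion S'.to_countable hd fun i _ => hQ.measurableSet i, ENNReal.tsum_mul_left]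
    _ ≤ ∑' i : S', lam (Q i) := ENNReal.tsum_le_tsum fun i => h i i.2.1
    _ = lam (⋃ i ∈ S', Q i) :=
      (measure_biUnion S'.to_countable hd fun i _ => hQ.measurableSet i).symm
    _ ≤ lam univ := measure_mono (subset_univ _)

/-- Layer cake: the integral is 2 ∫₀¹ t ν{F > t} dt, and the integrand is at most `K`. Truncating at
1 is what makes a weak type bound enough for an L² bound. -/
theorem lintegral_min_one_sq_le {ν : Measure X} {F : X → ℝ≥0∞} (hF : Measurable F) {K : ℝ≥0∞}
    (h : ∀ s : ℝ≥0∞, s * ν {x | s < F x} ≤ K) : ∫⁻ x, min (F x) 1 ^ 2 ∂ν ≤ 2 * K := by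
  have hm : ∀ x, min (F x) 1 ≠ ∞ := fun x => ne_top_of_le_ne_top ENNReal.one_ne_top (min_le_right _ _)
  have h1 := lintegral_rpow_eq_lintegral_meas_lt_mul ν (f := fun x => (min (F x) 1).toReal)
    (Eventually.of_forall fun x => ENNReal.toReal_nonneg)
    (hF.min measurable_const).ennreal_toReal.aemeasurable (p := 2) two_pos
  have h2 : ∀ x, ENNReal.ofReal ((min (F x) 1).toReal ^ (2 : ℝ)) = min (F x) 1 ^ 2 := by
    intro x
    rw [Real.rpow_two, ENNReal.ofReal_pow ENNReal.toReal_nonneg, ENNReal.ofReal_toReal (hm x)]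
  simp only [h2] at h1
  rw [h1]
  have h3 : ∀ t ∈ Ioi (0 : ℝ), ν {x | t < (min (F x) 1).toReal} * ENNReal.ofReal (t ^ ((2 : ℝ) - 1))
      ≤ (Iio (1 : ℝ)).indicator (fun _ => K) t := by
    intro t ht
    have ht' : (0 : ℝ) < t := ht
    have h4 : ∀ x, t < (min (F x) 1).toReal ↔ ENNReal.ofReal t < min (F x) 1 := fun x =>
      (ENNReal.ofReal_lt_iff_lt_toReal ht'.le (hm x)).symm
    simp only [h4]
    by_cases h5 : t < 1
    · rw [indicator_of_mem (by exact h5), show (2 : ℝ) - 1 = 1 by norm_num, Real.rpow_one, mul_comm]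
      refine le_trans ?_ (h (ENNReal.ofReal t))
      gcongr
      exact min_le_left _ _
    · have : {x | ENNReal.ofReal t < min (F x) 1} = ∅ := by
        ext x
        simp only [mem_ofPred_eq, mem_empty_iff_false, iff_false, not_lt]
        exact (min_le_right _ _).trans (by simpa using h5)
      rw [this]; simp
  calc ENNReal.ofReal 2 * ∫⁻ t in Ioi (0 : ℝ),
        ν {x | t < (min (F x) 1).toReal} * ENNReal.ofReal (t ^ ((2 : ℝ) - 1))
      ≤ ENNReal.ofReal 2 * ∫⁻ t in Ioi (0 : ℝ), (Iio (1 : ℝ)).indicator (fun _ => K) t := by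
        gcongr 1
        exact setLIntegral_mono' measurableSet_Ioi h3
    _ = 2 * K := by
        rw [lintegral_indicator measurableSet_Iio, setLIntegral_const,
          Measure.restrict_apply measurableSet_Iio, inter_comm, Ioi_inter_Iio, Real.volume_Ioo]
        simp

/-- Expand (2Ka - b)² ≥ 0. The weights are chosen so that, after integration, the term 2 ν(E) on the
right can be absorbed into 4 ν(E) on the left. -/
theorem four_mul_mul_le_sq_add_sq {K a b : ℝ≥0∞} (hK : K ≠ ∞) (ha : a ≠ ∞) (hb : b ≠ ∞) :
    4 * (K * (a * b)) ≤ 4 * K ^ 2 * a ^ 2 + b ^ 2 := by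
  lift K to ℝ≥0 using hK
  lift a to ℝ≥0 using ha
  lift b to ℝ≥0 using hb
  have : 4 * ((K : ℝ) * (a * b)) ≤ 4 * (K : ℝ) ^ 2 * a ^ 2 + b ^ 2 := by
    nlinarith [sq_nonneg (2 * (K : ℝ) * a - b)]
  exact_mod_cast this

/-- Weak type estimate for the positive operator with kernel adapted to a sparse nested family. -/
theorem IsNestedFamily.measure_one_lt_tsum_le {gen : ι → ℕ} {Q T : ι → Set X}
    (hQ : IsNestedFamily gen Q) (hT : ∀ i, MeasurableSet (T i)) (hTQ : ∀ i, T i ⊆ Q i)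
    (hTd : Pairwise fun i j => Disjoint (T i) (T j)) {ν lam : Measure X} (hν : ν univ ≠ ∞)
    {K : ℝ≥0∞} (hK : K ≠ ∞) (hQT : ∀ i, ν (Q i) ≤ K * ν (T i)) {a : ι → ℝ≥0∞}
    (ha : ∀ i, a i * ν (Q i) ≤ lam (Q i)) :
    ν {x | 1 < ∑' i, (Q i).indicator (fun _ => a i) x} ≤ (1 + 4 * K ^ 2) * lam univ := by
  set A : X → ℝ≥0∞ := fun x => ∑' i, (Q i).indicator (fun _ => a i) x with hA
  have hAm : Measurable A :=
    Measurable.tsum fun i => measurable_const.indicator (hQ.measurableSet i)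
  have hsup_m : ∀ c : ι → ℝ≥0∞, Measurable fun x => ⨆ i, (Q i).indicator (fun _ => c i) x :=
    fun c => Measurable.iSup fun i => measurable_const.indicator (hQ.measurableSet i)
  have hsup_lt : ∀ (c : ι → ℝ≥0∞) (s : ℝ≥0∞),
      {x | s < ⨆ i, (Q i).indicator (fun _ => c i) x} = ⋃ i ∈ {i | s < c i}, Q i := by
    intro c s
    ext x
    simp only [mem_ofPred_eq, lt_iSup_iff, mem_iUnion, exists_prop]
    refine exists_congr fun i => ?_
    by_cases hx : x ∈ Q i <;> simp [hx]
  have hweak : ∀ (c : ι → ℝ≥0∞) (lam' : Measure X), (∀ i, c i * ν (Q i) ≤ lam' (Q i)) →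
      ∀ s : ℝ≥0∞, s * ν {x | s < ⨆ i, (Q i).indicator (fun _ => c i) x} ≤ lam' univ := by
    intro c lam' hc s
    rw [hsup_lt]
    refine hQ.mul_measure_biUnion_le _ _ fun i hi => le_trans ?_ (hc i)
    have : s ≤ c i := le_of_lt hi
    gcongr
  set M : X → ℝ≥0∞ := fun x => ⨆ i, (Q i).indicator (fun _ => a i) x with hM
  have hMm : Measurable M := hsup_m a
  -- The set where `M` exceeds 1 is handled by the maximal inequality; `E` is the rest of the level
  -- set.
  set E : Set X := {x | 1 < A x} \ {x | 1 < M x} with hE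
  have hEm : MeasurableSet E :=
    (measurableSet_lt measurable_const hAm).diff (measurableSet_lt measurable_const hMm)
  have hνE : ν E ≠ ∞ := ne_top_of_le_ne_top hν (measure_mono (subset_univ _))
  -- The averages of 1_E, whose supremum `m` below is the dyadic maximal function of 1_E.
  set r : ι → ℝ≥0∞ := fun i => ν (Q i ∩ E) / ν (Q i) with hr
  have hrν : ∀ i, r i * ν (Q i) = ν (Q i ∩ E) := fun i =>
    ENNReal.div_mul_cancel' (fun h => measure_mono_null inter_subset_left h)
      (fun h => absurd h (ne_top_of_le_ne_top hν (measure_mono (subset_univ _))))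
  have hr1 : ∀ i, r i ≤ 1 := fun i =>
    ENNReal.div_le_of_le_mul (by rw [one_mul]; exact measure_mono inter_subset_left)
  set m : X → ℝ≥0∞ := fun x => ⨆ i, (Q i).indicator (fun _ => r i) x with hm
  have hmm : Measurable m := hsup_m r
  have hM2 : ∫⁻ x, min (M x) 1 ^ 2 ∂ν ≤ 2 * lam univ :=
    lintegral_min_one_sq_le hMm (hweak a lam ha)
  have hm2 : ∫⁻ x, min (m x) 1 ^ 2 ∂ν ≤ 2 * ν E := by
    refine lintegral_min_one_sq_le hmm fun s => ?_
    have := hweak r (ν.restrict E) (fun i => ?_) s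
    · rwa [Measure.restrict_apply_univ] at this
    · rw [hrν, Measure.restrict_apply (hQ.measurableSet i)]
  -- On `T i` one has `M ≥ a i` and `m ≥ r i`. If `Q i` meets `E`, then `a i ≤ 1` because `M ≤ 1` on
  -- `E`, so the truncation loses nothing; otherwise the term is zero.
  have hterm : ∀ i, a i * ν (Q i ∩ E) ≤ K * ∫⁻ x in T i, min (M x) 1 * min (m x) 1 ∂ν := by
    intro i
    rcases (Q i ∩ E).eq_empty_or_nonempty with h0 | ⟨x, hxQ, hxE⟩
    · simp [h0]
    have hle : ∀ c : ι → ℝ≥0∞, ∀ y ∈ Q i, c i ≤ ⨆ j, (Q j).indicator (fun _ => c j) y := by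
      intro c y hy
      refine le_trans ?_ (le_iSup _ i)
      rw [indicator_of_mem hy]
    have hai : a i ≤ 1 := (hle a x hxQ).trans (not_lt.1 hxE.2)
    calc a i * ν (Q i ∩ E) = a i * (r i * ν (Q i)) := by rw [hrν]
      _ ≤ a i * (r i * (K * ν (T i))) := by gcongr; exact hQT i
      _ = K * ∫⁻ x in T i, a i * r i ∂ν := by rw [setLIntegral_const]; ring
      _ ≤ K * ∫⁻ x in T i, min (M x) 1 * min (m x) 1 ∂ν := by
        gcongr 1
        refine setLIntegral_mono' (hT i) fun y hy => ?_
        exact mul_le_mul' (le_min (hle a y (hTQ i hy)) hai) (le_min (hle r y (hTQ i hy)) (hr1 i))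
  have hEA : ν E ≤ K * ∫⁻ x, min (M x) 1 * min (m x) 1 ∂ν := by
    calc ν E = ∫⁻ x in E, 1 ∂ν := by simp
      _ ≤ ∫⁻ x in E, A x ∂ν := setLIntegral_mono' hEm fun x hx => le_of_lt hx.1
      _ = ∑' i, a i * ν (Q i ∩ E) := by
        rw [hA, lintegral_tsum fun i => (measurable_const.indicator (hQ.measurableSet i)).aemeasurable]
        refine tsum_congr fun i => ?_
        rw [lintegral_indicator (hQ.measurableSet i), setLIntegral_const,
          Measure.restrict_apply (hQ.measurableSet i)]
      _ ≤ ∑' i, K * ∫⁻ x in T i, min (M x) 1 * min (m x) 1 ∂ν := ENNReal.tsum_le_tsum hterm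
      _ = K * ∫⁻ x in ⋃ i, T i, min (M x) 1 * min (m x) 1 ∂ν := by
        rw [ENNReal.tsum_mul_left, lintegral_iUnion hT hTd]
      _ ≤ K * ∫⁻ x, min (M x) 1 * min (m x) 1 ∂ν := by
        gcongr 1
        exact setLIntegral_le_lintegral _ _
  have hmin : ∀ y : ℝ≥0∞, min y 1 ≠ ∞ := fun y =>
    ne_top_of_le_ne_top ENNReal.one_ne_top (min_le_right _ _)
  have h4 : 4 * ν E ≤ 8 * K ^ 2 * lam univ + 2 * ν E := by
    calc 4 * ν E ≤ 4 * (K * ∫⁻ x, min (M x) 1 * min (m x) 1 ∂ν) := by gcongr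
      _ = ∫⁻ x, 4 * (K * (min (M x) 1 * min (m x) 1)) ∂ν := by
        rw [lintegral_const_mul' _ _ (by simp), lintegral_const_mul' _ _ hK]
      _ ≤ ∫⁻ x, 4 * K ^ 2 * min (M x) 1 ^ 2 + min (m x) 1 ^ 2 ∂ν :=
        lintegral_mono fun x => four_mul_mul_le_sq_add_sq hK (hmin _) (hmin _)
      _ = 4 * K ^ 2 * ∫⁻ x, min (M x) 1 ^ 2 ∂ν + ∫⁻ x, min (m x) 1 ^ 2 ∂ν := by
        rw [lintegral_add_right _ ((hmm.min measurable_const).pow_const 2),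
          lintegral_const_mul' _ _ (by finiteness)]
      _ ≤ 4 * K ^ 2 * (2 * lam univ) + 2 * ν E := by gcongr
      _ = 8 * K ^ 2 * lam univ + 2 * ν E := by ring
  -- Absorption, legitimate because `ν E` is finite.
  have h5 : ν E ≤ 4 * K ^ 2 * lam univ := by
    have h6 : 2 * ν E + 2 * ν E ≤ 8 * K ^ 2 * lam univ + 2 * ν E := by
      refine le_trans (le_of_eq ?_) h4; ring
    have h7 := (ENNReal.add_le_add_iff_right (by finiteness)).1 h6
    rw [show (8 : ℝ≥0∞) * K ^ 2 * lam univ = 2 * (4 * K ^ 2 * lam univ) by ring] at h7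
    exact (ENNReal.mul_le_mul_iff_right two_ne_zero ENNReal.ofNat_ne_top).1 h7
  calc ν {x | 1 < A x} ≤ ν ({x | 1 < M x} ∪ E) := by
        refine measure_mono fun x hx => ?_
        by_cases h : 1 < M x
        · exact Or.inl h
        · exact Or.inr ⟨hx, h⟩
    _ ≤ ν {x | 1 < M x} + ν E := measure_union_le _ _
    _ ≤ lam univ + 4 * K ^ 2 * lam univ := by
        exact add_le_add (by simpa only [one_mul] using hweak a lam ha 1) h5
    _ = (1 + 4 * K ^ 2) * lam univ := by ring

end Sparse

/-! ### Dyadic grids of Carleson boxes -/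

theorem IsNestedFamily.image {X Y ι : Type*} [MeasurableSpace X] [MeasurableSpace Y] {gen : ι → ℕ}
    {Q : ι → Set X} (hQ : IsNestedFamily gen Q) {s : Set X} (hs : ∀ i, Q i ⊆ s) {g : X → Y}
    (hg : InjOn g s) (hm : ∀ i, MeasurableSet (g '' Q i)) :
    IsNestedFamily gen fun i => g '' Q i where
  measurableSet := hm
  subset i j hij hne := by
    rw [← hg.image_inter (hs i) (hs j)] at hne
    exact image_mono (hQ.subset i j hij hne.of_image)
  disjoint i j hij hne := (hQ.disjoint i j hij hne).image hg (hs i) (hs j)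

/-- The floor of 2ⁿx determines the floor of x, hence the index of the dyadic interval of the
fractional part. This moves grid comparisons from the circle to the line. -/
theorem floor_two_pow_mul_fract_congr {n : ℕ} {x y : ℝ} (h : ⌊2 ^ n * x⌋ = ⌊2 ^ n * y⌋) :
    ⌊2 ^ n * Int.fract x⌋₊ = ⌊2 ^ n * Int.fract y⌋₊ := by
  have hfl : ∀ t : ℝ, ⌊t⌋ = ⌊2 ^ n * t⌋ / ((2 ^ n : ℕ) : ℤ) := fun t => by
    rw [← Int.floor_div_natCast]
    congr 1
    push_cast
    field_simp
  have hk : ∀ t : ℝ, ⌊2 ^ n * Int.fract t⌋₊ = (⌊2 ^ n * t⌋ - 2 ^ n * ⌊t⌋).toNat := fun t => by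
    rw [← Int.floor_toNat, ← Int.floor_sub_intCast]
    congr 2
    rw [Int.fract]
    push_cast
    ring
  rw [hk, hk, hfl x, hfl y, h]

/-- The one-third trick: two close points lie in the same interval of a grid or of its shift. -/
theorem floor_eq_or_floor_sub_third_eq {n : ℕ} {y η : ℝ} (hη : |η| < 1 / 6) :
    ⌊y + η⌋ = ⌊y⌋ ∨ ⌊y - 2 ^ n / 3 + η⌋ = ⌊y - 2 ^ n / 3⌋ := by
  have key : ∀ t : ℝ, ⌊t + η⌋ ≠ ⌊t⌋ → ∃ p : ℤ, |t - p| < 1 / 6 := by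
    intro t ht
    rw [abs_lt] at hη
    rcases lt_or_gt_of_ne ht with h | h
    · refine ⟨⌊t⌋, ?_⟩
      have h1 := Int.floor_lt.1 h
      have h2 := Int.floor_le t
      rw [abs_lt]; constructor <;> linarith
    · refine ⟨⌊t + η⌋, ?_⟩
      have h1 := Int.floor_lt.1 h
      have h2 := Int.floor_le (t + η)
      rw [abs_lt]; constructor <;> linarith
  -- If both fail, y and y - 2ⁿ/3 are each within 1/6 of integers p and q, so |2ⁿ - 3(p - q)| < 1.
  -- This forces 3 to divide 2ⁿ.
  by_contra! hc
  obtain ⟨p, hp⟩ := key _ hc.1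
  obtain ⟨q, hq⟩ := key _ hc.2
  rw [abs_lt] at hp hq
  have h1 : ((2 ^ n - 3 * (p - q) : ℤ) : ℝ) < 1 := by push_cast; linarith
  have h2 : (-1 : ℝ) < ((2 ^ n - 3 * (p - q) : ℤ) : ℝ) := by push_cast; linarith
  have h1' : (2 ^ n - 3 * (p - q) : ℤ) < 1 := by exact_mod_cast h1
  have h2' : -1 < (2 ^ n - 3 * (p - q) : ℤ) := by exact_mod_cast h2
  have h3 : (2 ^ n : ℤ) = 3 * (p - q) := by omega
  have h4 : (3 : ℤ) ∣ 2 := Int.prime_three.dvd_of_dvd_pow (Dvd.intro _ h3.symm)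
  omega

/-- Jordan's inequality (2/π)|θ| ≤ |sin θ| on [-π/2, π/2], with sin θ = Im w / |w|. -/
theorem abs_arg_le_of_re_nonneg {w : ℂ} (hw : 0 ≤ w.re) :
    |w.arg| ≤ Real.pi / 2 * (|w.im| / ‖w‖) := by
  have h := Real.mul_abs_le_abs_sin (Complex.abs_arg_le_pi_div_two_iff.2 hw)
  rw [Complex.sin_arg, abs_div, abs_norm] at h
  have hπ := Real.pi_pos
  calc |w.arg| = Real.pi / 2 * (2 / Real.pi * |w.arg|) := by field_simp
    _ ≤ _ := by gcongr

theorem exists_arg_eq_of_eq_norm_mul_exp {z : ℂ} (hz : z ≠ 0) {t : ℝ}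
    (h : z = ‖z‖ * Complex.exp (t * Complex.I)) : ∃ m : ℤ, z.arg = t + m * (2 * Real.pi) := by
  have h1 : Complex.exp (z.arg * Complex.I) = Complex.exp (t * Complex.I) := by
    have hn : (‖z‖ : ℂ) ≠ 0 := by simpa using hz
    refine mul_left_cancel₀ hn ?_
    rw [← h, Complex.norm_mul_exp_arg_mul_I]
  obtain ⟨m, hm⟩ := Complex.exp_eq_exp_iff_exists_int.1 h1
  refine ⟨m, ?_⟩
  have h2 : ((z.arg : ℝ) : ℂ) = ((t + m * (2 * Real.pi) : ℝ) : ℂ) := by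
    refine mul_right_cancel₀ Complex.I_ne_zero ?_
    rw [hm]; push_cast; ring
  exact_mod_cast h2

/-! ### The shifted dyadic grids on the disc -/

/-- The position of `z` on the unit circle, shifted by `α` and normalized to `[0, 1)`. -/
noncomputable def gridPos (α : ℝ) (z : ℂ) : ℝ := Int.fract (z.arg / (2 * Real.pi) - α)

/-- The `p.2`-th box of generation `p.1` of the dyadic grid shifted by `α`. -/
def gridBox (α : ℝ) (p : ℕ × ℕ) : Set ℂ :=
  {z | ‖z‖ < 1 ∧ 1 - ‖z‖ ≤ ((2 : ℝ) ^ p.1)⁻¹ ∧ ⌊2 ^ p.1 * gridPos α z⌋₊ = p.2}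

/-- The top half of a dyadic box. -/
def gridTop (α : ℝ) (p : ℕ × ℕ) : Set ℂ :=
  gridBox α p ∩ {z | ((2 : ℝ) ^ (p.1 + 1))⁻¹ < 1 - ‖z‖}

theorem measurable_gridPos (α : ℝ) : Measurable (gridPos α) :=
  ((Complex.measurable_arg.div_const _).sub_const _).fract

theorem gridBox_subset_ball (α : ℝ) (p : ℕ × ℕ) : gridBox α p ⊆ ball 0 1 := fun z hz => by
  simpa using hz.1

theorem measurableSet_gridBox (α : ℝ) (p : ℕ × ℕ) : MeasurableSet (gridBox α p) := by
  refine (measurableSet_lt measurable_norm measurable_const).inter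
    ((measurableSet_le (measurable_const.sub measurable_norm) measurable_const).inter ?_)
  exact (Nat.measurable_floor.comp ((measurable_gridPos α).const_mul _)) (measurableSet_singleton p.2)

theorem measurableSet_gridTop (α : ℝ) (p : ℕ × ℕ) : MeasurableSet (gridTop α p) :=
  (measurableSet_gridBox α p).inter
    (measurableSet_lt measurable_const (measurable_const.sub measurable_norm))

theorem isNestedFamily_gridBox (α : ℝ) : IsNestedFamily Prod.fst (gridBox α) where
  measurableSet := measurableSet_gridBox α
  subset := by
    rintro ⟨n, k⟩ ⟨m, l⟩ hnm ⟨z, hz, hz'⟩ w hw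
    simp only at hnm
    -- The index in generation `m` determines the index in every coarser generation `n`; this is the
    -- nesting.
    have hfl : ∀ t : ℝ, ⌊2 ^ n * t⌋₊ = ⌊2 ^ m * t⌋₊ / 2 ^ (m - n) := fun t => by
      rw [← Nat.floor_div_natCast]
      congr 1
      push_cast
      rw [eq_div_iff (by positivity), mul_right_comm, ← pow_add, Nat.add_sub_cancel' hnm]
    refine ⟨hw.1, hw.2.1.trans ?_, ?_⟩
    · simp only
      gcongr
      norm_num
    · have h1 := hz.2.2
      have h2 := hz'.2.2
      have h3 := hw.2.2
      simp only at h1 h2 h3 ⊢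
      rw [hfl, h3, ← h2, ← hfl, h1]
  disjoint := by
    rintro ⟨n, k⟩ ⟨m, l⟩ hnm hne
    simp only at hnm
    subst hnm
    refine Set.disjoint_left.2 fun z hz hz' => hne ?_
    have h1 := hz.2.2
    have h2 := hz'.2.2
    simp only at h1 h2
    rw [← h1, ← h2]

theorem pairwise_disjoint_gridTop (α : ℝ) :
    Pairwise fun p q => Disjoint (gridTop α p) (gridTop α q) := by
  have key : ∀ p q : ℕ × ℕ, p.1 < q.1 → Disjoint (gridTop α p) (gridTop α q) := by
    intro p q hpq
    refine Set.disjoint_left.2 fun z hz hz' => ?_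
    have h1 : ((2 : ℝ) ^ (p.1 + 1))⁻¹ < 1 - ‖z‖ := hz.2
    have h2 := hz'.1.2.1
    have h3 : ((2 : ℝ) ^ q.1)⁻¹ ≤ ((2 : ℝ) ^ (p.1 + 1))⁻¹ := by
      gcongr
      · norm_num
      · exact hpq
    linarith
  intro p q hpq
  rcases lt_trichotomy p.1 q.1 with h | h | h
  · exact key p q h
  · exact ((isNestedFamily_gridBox α).disjoint p q h hpq).mono inter_subset_left inter_subset_left
  · exact (key q p h).symm

/-- The angle of the center of the arc below a dyadic box. -/
noncomputable def gridCenter (α : ℝ) (p : ℕ × ℕ) : ℝ :=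
  2 * Real.pi * (α + (p.2 + 1 / 2) / 2 ^ p.1)

theorem gridBox_subset_carlesonBox (α : ℝ) (p : ℕ × ℕ) :
    gridBox α p ⊆ carlesonBox (gridCenter α p) ((2 : ℝ) ^ p.1)⁻¹ := by
  intro z hz
  have hπ := Real.pi_pos
  have h2 : (0 : ℝ) < 2 ^ p.1 := by positivity
  refine ⟨‖z‖, 2 * Real.pi * (gridPos α z + α), norm_nonneg _, hz.1, hz.2.1, ?_, ?_⟩
  · have h0 : 0 ≤ gridPos α z := Int.fract_nonneg _
    have h1 := (Nat.floor_eq_iff (by positivity)).1 hz.2.2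
    have h3 : 2 * Real.pi * (gridPos α z + α) - gridCenter α p
        = Real.pi * ((2 : ℝ) ^ p.1)⁻¹ * (2 * (2 ^ p.1 * gridPos α z) - 2 * p.2 - 1) := by
      rw [gridCenter]; field_simp; ring
    rw [h3, abs_mul, abs_of_pos (by positivity)]
    refine mul_le_of_le_one_right (by positivity) ?_
    rw [abs_le]
    constructor <;> linarith [h1.1, h1.2]
  · nth_rewrite 1 [← Complex.norm_mul_exp_arg_mul_I z]
    congr 1
    rw [Complex.exp_eq_exp_iff_exists_int]
    refine ⟨⌊z.arg / (2 * Real.pi) - α⌋, ?_⟩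
    have : z.arg = 2 * Real.pi * (gridPos α z + α) + ⌊z.arg / (2 * Real.pi) - α⌋ * (2 * Real.pi) := by
      rw [gridPos, Int.fract]; field_simp; ring
    nth_rewrite 1 [this]
    push_cast
    ring

/-! ### Measurability and area of Carleson boxes and top halves -/

theorem carlesonBox_subset_ball_zero (θ₀ ℓ : ℝ) : carlesonBox θ₀ ℓ ⊆ ball 0 1 := by
  rintro z ⟨r, θ, hr0, hr1, -, -, rfl⟩
  rw [mem_ball_zero_iff, norm_mul, Complex.norm_exp_ofReal_mul_I, mul_one, Complex.norm_real,
    Real.norm_of_nonneg hr0]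
  exact hr1

/-- Apart from the condition r < 1, the box is the continuous image of a compact rectangle in polar
coordinates. -/
theorem measurableSet_carlesonBox (θ₀ ℓ : ℝ) : MeasurableSet (carlesonBox θ₀ ℓ) := by
  set g : ℝ × ℝ → ℂ := fun p => p.1 * Complex.exp (p.2 * Complex.I)
  have hg : Continuous g := by fun_prop
  have h : carlesonBox θ₀ ℓ = ball 0 1 ∩ g ''
      (Icc (max 0 (1 - ℓ)) 1 ×ˢ Icc (θ₀ - Real.pi * ℓ) (θ₀ + Real.pi * ℓ)) := by
    ext z
    constructor
    · intro hz
      refine ⟨carlesonBox_subset_ball_zero _ _ hz, ?_⟩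
      obtain ⟨r, θ, hr0, hr1, hr, hθ, rfl⟩ := hz
      rw [abs_le] at hθ
      exact ⟨(r, θ), ⟨⟨max_le hr0 (by linarith), hr1.le⟩, ⟨by linarith, by linarith⟩⟩, rfl⟩
    · rintro ⟨hz, ⟨r, θ⟩, ⟨⟨hr0, hr1⟩, hθ0, hθ1⟩, rfl⟩
      have h0 : 0 ≤ r := (le_max_left _ _).trans hr0
      have h1 : 1 - ℓ ≤ r := (le_max_right _ _).trans hr0
      simp only [g, mem_ball_zero_iff, norm_mul, Complex.norm_exp_ofReal_mul_I, mul_one,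
        Complex.norm_real, Real.norm_of_nonneg h0] at hz
      simp only at hθ0 hθ1
      exact ⟨r, θ, h0, hz, by linarith, abs_le.2 ⟨by linarith, by linarith⟩, rfl⟩
  rw [h]
  exact measurableSet_ball.inter ((isCompact_Icc.prod isCompact_Icc).image hg).measurableSet

theorem carlesonBox_subset_closedBall (θ₀ ℓ : ℝ) :
    carlesonBox θ₀ ℓ ⊆ closedBall (Complex.exp (θ₀ * Complex.I)) ((1 + Real.pi) * ℓ) := by
  rintro z ⟨r, θ, hr0, hr1, hr, hθ, rfl⟩
  rw [mem_closedBall, dist_eq_norm]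
  have h1 : ‖Complex.exp (θ * Complex.I) - Complex.exp (θ₀ * Complex.I)‖ ≤ |θ - θ₀| := by
    have h := Real.norm_exp_I_mul_ofReal_sub_one_le (x := θ - θ₀)
    have h2 : Complex.exp (θ * Complex.I) - Complex.exp (θ₀ * Complex.I) =
        Complex.exp (θ₀ * Complex.I) * (Complex.exp (Complex.I * ((θ - θ₀ : ℝ) : ℂ)) - 1) := by
      rw [mul_sub, ← Complex.exp_add, mul_one]
      congr 2
      push_cast
      ring
    rw [h2, norm_mul, Complex.norm_exp_ofReal_mul_I, one_mul]
    simpa using h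
  calc ‖(r : ℂ) * Complex.exp (θ * Complex.I) - Complex.exp (θ₀ * Complex.I)‖
      = ‖((r - 1 : ℝ) : ℂ) * Complex.exp (θ * Complex.I) +
          (Complex.exp (θ * Complex.I) - Complex.exp (θ₀ * Complex.I))‖ := by
        congr 1; push_cast; ring
    _ ≤ |r - 1| + |θ - θ₀| := by
        refine (norm_add_le _ _).trans (add_le_add ?_ h1)
        rw [norm_mul, Complex.norm_exp_ofReal_mul_I, mul_one, Complex.norm_real, Real.norm_eq_abs]
    _ ≤ (1 + Real.pi) * ℓ := by
        rw [abs_of_nonpos (by linarith)]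
        linarith

/-- The box lies in a disc of radius (1 + π)ℓ about the center of its arc; 100 = 5² · 4 from 1 + π ≤
5 and π ≤ 4. -/
theorem volume_carlesonBox_le (θ₀ ℓ : ℝ) :
    volume (carlesonBox θ₀ ℓ) ≤ 100 * ENNReal.ofReal ℓ ^ 2 := by
  refine (measure_mono (carlesonBox_subset_closedBall θ₀ ℓ)).trans ?_
  rw [Complex.volume_closedBall, ENNReal.ofReal_mul (by positivity), mul_pow]
  have h1 : ENNReal.ofReal (1 + Real.pi) ≤ 5 := by
    rw [← ENNReal.ofReal_ofNat]
    exact ENNReal.ofReal_le_ofReal (by linarith [Real.pi_le_four])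
  have h2 : (NNReal.pi : ℝ≥0∞) ≤ 4 := by
    exact_mod_cast Real.pi_le_four
  calc ENNReal.ofReal (1 + Real.pi) ^ 2 * ENNReal.ofReal ℓ ^ 2 * (NNReal.pi : ℝ≥0∞)
      ≤ 5 ^ 2 * ENNReal.ofReal ℓ ^ 2 * 4 := by gcongr
    _ = 100 * ENNReal.ofReal ℓ ^ 2 := by ring

theorem gridBox_eq_empty {α : ℝ} {p : ℕ × ℕ} (hp : 2 ^ p.1 ≤ p.2) : gridBox α p = ∅ := by
  refine eq_empty_of_forall_notMem fun z hz => ?_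
  have h1 : gridPos α z < 1 := Int.fract_lt_one _
  have h0 : 0 ≤ gridPos α z := Int.fract_nonneg _
  have h2 := (Nat.floor_eq_iff (by positivity)).1 hz.2.2
  have h3 : ((2 : ℝ) ^ p.1) ≤ p.2 := by exact_mod_cast hp
  have h4 : (2 : ℝ) ^ p.1 * gridPos α z < 2 ^ p.1 * 1 := by gcongr
  linarith [h2.1]

/-- The distances to the circle in the top half range from ℓ/2 to ℓ. The disc is centered at
distance 3ℓ/4, above the midpoint of the arc, and ℓ/10 is small enough to stay inside in both
directions. -/
theorem ball_subset_gridTop (α : ℝ) {p : ℕ × ℕ} (hp : p.2 < 2 ^ p.1) :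
    ball (((1 - 3 / 4 * ((2 : ℝ) ^ p.1)⁻¹ : ℝ) : ℂ) * Complex.exp (gridCenter α p * Complex.I))
      (((2 : ℝ) ^ p.1)⁻¹ / 10) ⊆ gridTop α p := by
  intro z hz
  set ℓ : ℝ := ((2 : ℝ) ^ p.1)⁻¹ with hℓ
  have hπ := Real.pi_pos
  have hℓ0 : 0 < ℓ := by positivity
  have hℓ1 : ℓ ≤ 1 := inv_le_one_of_one_le₀ (one_le_pow₀ (by norm_num))
  have hℓ2 : (2 : ℝ) ^ p.1 * ℓ = 1 := mul_inv_cancel₀ (by positivity)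
  set w : ℂ := z * Complex.exp (-(gridCenter α p * Complex.I)) with hw
  have hzw : z = w * Complex.exp (gridCenter α p * Complex.I) := by
    rw [hw, mul_assoc, ← Complex.exp_add]; simp
  have hnw : ‖w‖ = ‖z‖ := by
    rw [hzw, norm_mul w, Complex.norm_exp_ofReal_mul_I, mul_one]
  have hd : ‖w - ((1 - 3 / 4 * ℓ : ℝ) : ℂ)‖ < ℓ / 10 := by
    rw [mem_ball, dist_eq_norm, hzw, ← sub_mul, norm_mul, Complex.norm_exp_ofReal_mul_I, mul_one]
      at hz
    exact hz
  have hnorm := (abs_norm_sub_norm_le w ((1 - 3 / 4 * ℓ : ℝ) : ℂ)).trans_lt hd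
  rw [Complex.norm_real, Real.norm_of_nonneg (by linarith), abs_lt, hnw] at hnorm
  have hre := (Complex.abs_re_le_norm _).trans_lt hd
  have him := (Complex.abs_im_le_norm _).trans_lt hd
  rw [Complex.sub_re, Complex.ofReal_re, abs_lt] at hre
  rw [Complex.sub_im, Complex.ofReal_im, sub_zero] at him
  have hz15 : 3 / 20 < ‖z‖ := by linarith [hnorm.1]
  -- After rotation |Im w| < ℓ/10 and |w| > 3/20, whose quotient is 2ℓ/3. The angle is then at most
  -- one sixth of the box's width.
  have hδ : |w.arg| ≤ Real.pi / 2 * (2 / 3 * ℓ) := by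
    refine (abs_arg_le_of_re_nonneg (by linarith [hre.1])).trans ?_
    gcongr
    rw [hnw, div_le_iff₀ (by linarith)]
    nlinarith
  have hz0 : z ≠ 0 := by rintro rfl; simp at hz15; linarith
  have hzexp : z = ‖z‖ * Complex.exp (((w.arg + gridCenter α p : ℝ) : ℂ) * Complex.I) := by
    rw [← hnw, Complex.ofReal_add, add_mul, Complex.exp_add, ← mul_assoc,
      Complex.norm_mul_exp_arg_mul_I, ← hzw]
  obtain ⟨m, hm⟩ := exists_arg_eq_of_eq_norm_mul_exp hz0 hzexp
  have hδ' : |2 ^ p.1 * (w.arg / (2 * Real.pi))| ≤ 1 / 6 := by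
    rw [abs_mul, abs_div, abs_of_pos (by positivity : (0 : ℝ) < 2 ^ p.1),
      abs_of_pos (by positivity : (0 : ℝ) < 2 * Real.pi)]
    calc 2 ^ p.1 * (|w.arg| / (2 * Real.pi))
        ≤ 2 ^ p.1 * (Real.pi / 2 * (2 / 3 * ℓ) / (2 * Real.pi)) := by gcongr
      _ = (2 ^ p.1 * ℓ) / 6 := by field_simp; norm_num
      _ = 1 / 6 := by rw [hℓ2]
  rw [abs_le] at hδ'
  have hp' : (p.2 : ℝ) + 1 ≤ 2 ^ p.1 := by exact_mod_cast hp
  have hp0 : (0 : ℝ) ≤ p.2 := Nat.cast_nonneg _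
  set s : ℝ := w.arg / (2 * Real.pi) + (p.2 + 1 / 2) / 2 ^ p.1 with hs
  have hs2 : 2 ^ p.1 * s = 2 ^ p.1 * (w.arg / (2 * Real.pi)) + (p.2 + 1 / 2) := by
    rw [hs]; field_simp
  have hpos : gridPos α z = s := by
    have h1 : z.arg / (2 * Real.pi) - α = s + m := by
      rw [hm, hs, gridCenter]; field_simp; ring
    rw [gridPos, h1, Int.fract_add_intCast, Int.fract_eq_self]
    constructor
    · by_contra! hc
      nlinarith [mul_neg_of_pos_of_neg (by positivity : (0 : ℝ) < 2 ^ p.1) hc]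
    · by_contra! hc
      have : (2 : ℝ) ^ p.1 * 1 ≤ 2 ^ p.1 * s := by gcongr
      linarith
  refine ⟨⟨by linarith [hnorm.2], by linarith [hnorm.1], ?_⟩, ?_⟩
  · rw [hpos, hs2, Nat.floor_eq_iff (by linarith)]
    constructor <;> linarith
  · have : ((2 : ℝ) ^ (p.1 + 1))⁻¹ = ℓ / 2 := by rw [pow_succ, mul_inv, hℓ]; ring
    simp only [mem_ofPred_eq]
    rw [this]
    linarith [hnorm.2]

theorem le_volume_gridTop (α : ℝ) {p : ℕ × ℕ} (hp : p.2 < 2 ^ p.1) :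
    ENNReal.ofReal ((2 : ℝ) ^ p.1)⁻¹ ^ 2 ≤ 100 * volume (gridTop α p) := by
  refine le_trans ?_ (mul_le_mul_right (measure_mono (ball_subset_gridTop α hp)) _)
  rw [Complex.volume_ball, ENNReal.ofReal_div_of_pos (by norm_num)]
  have h1 : (1 : ℝ≥0∞) ≤ NNReal.pi := by
    exact_mod_cast (by linarith [Real.pi_gt_three] : (1 : ℝ) ≤ Real.pi)
  rw [ENNReal.ofReal_ofNat, div_eq_mul_inv, mul_pow, ← ENNReal.inv_pow, ← div_eq_mul_inv]
  calc ENNReal.ofReal ((2 : ℝ) ^ p.1)⁻¹ ^ 2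
      = 100 * (ENNReal.ofReal ((2 : ℝ) ^ p.1)⁻¹ ^ 2 / 10 ^ 2) := by
        rw [show (10 : ℝ≥0∞) ^ 2 = 100 by norm_num, ENNReal.mul_div_cancel (by simp) (by simp)]
    _ ≤ 100 * (ENNReal.ofReal ((2 : ℝ) ^ p.1)⁻¹ ^ 2 / 10 ^ 2 * NNReal.pi) := by
        gcongr
        exact le_mul_of_one_le_right' h1

/-! ### A common box for two points of the disc -/

theorem one_sub_norm_le_norm_one_sub_mul_conj {z w : ℂ} (hw : ‖w‖ < 1) :
    1 - ‖z‖ ≤ ‖1 - z * (starRingEnd ℂ) w‖ := by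
  have h := norm_sub_norm_le 1 (z * (starRingEnd ℂ) w)
  rw [norm_one, norm_mul, RCLike.norm_conj] at h
  have := mul_le_of_le_one_right (norm_nonneg z) hw.le
  linarith

/-- Two points of the disc lie in a common box of size comparable to `|1 - z w̄|`. -/
theorem exists_mem_gridBox {z w : ℂ} (hz : ‖z‖ < 1) (hw : ‖w‖ < 1) :
    ∃ α : ℝ, (α = 0 ∨ α = 1 / 3) ∧ ∃ p : ℕ × ℕ, z ∈ gridBox α p ∧ w ∈ gridBox α p ∧
      ((2 : ℝ) ^ p.1)⁻¹ ≤ 6 * ‖1 - z * (starRingEnd ℂ) w‖ := by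
  set d := ‖1 - z * (starRingEnd ℂ) w‖ with hd
  have hzd : 1 - ‖z‖ ≤ d := one_sub_norm_le_norm_one_sub_mul_conj hw
  have hwd : 1 - ‖w‖ ≤ d := by
    have h := one_sub_norm_le_norm_one_sub_mul_conj (z := w) hz
    have h2 : ‖1 - w * (starRingEnd ℂ) z‖ = d := by
      rw [hd, ← RCLike.norm_conj (1 - w * (starRingEnd ℂ) z)]
      congr 1
      simp [mul_comm]
    rwa [h2] at h
  have hd0 : 0 < d := by linarith
  have hπ := Real.pi_pos
  rcases le_or_gt (1 / 3) d with h3 | h3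
  · have hk : ∀ v : ℂ, ⌊(2 : ℝ) ^ 0 * gridPos 0 v⌋₊ = 0 := fun v => by
      rw [pow_zero, one_mul]
      exact Nat.floor_eq_zero.2 (Int.fract_lt_one _)
    refine ⟨0, Or.inl rfl, (0, 0), ⟨hz, ?_, hk z⟩, ⟨hw, ?_, hk w⟩, ?_⟩
    · simp
    · simp
    · simp only [pow_zero, inv_one]; linarith
  -- The generation is chosen so that d ≤ 2⁻ⁿ ≤ 6d. The strict bound 2ⁿd < 1/3 keeps the angular
  -- distance, measured in box widths, below 1/8, within the 1/6 that the one-third trick allows.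
  obtain ⟨n, hn1, hn2⟩ : ∃ n : ℕ, (2 : ℝ) ^ n * d < 1 / 3 ∧ 1 / 3 ≤ (2 : ℝ) ^ (n + 1) * d := by
    have hex : ∃ n : ℕ, 1 / 3 ≤ (2 : ℝ) ^ n * d := by
      obtain ⟨n, hn⟩ := pow_unbounded_of_one_lt (1 / 3 / d) (one_lt_two : (1 : ℝ) < 2)
      exact ⟨n, ((div_lt_iff₀ hd0).1 hn).le⟩
    classical
    have hpos : Nat.find hex ≠ 0 := fun h => by
      have := Nat.find_spec hex
      rw [h, pow_zero, one_mul] at this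
      linarith
    obtain ⟨n, hn⟩ := Nat.exists_eq_succ_of_ne_zero hpos
    refine ⟨n, not_le.1 (Nat.find_min hex (by omega)), ?_⟩
    have := Nat.find_spec hex
    rwa [hn] at this
  have h2n : (0 : ℝ) < 2 ^ n := by positivity
  have hdn : d ≤ ((2 : ℝ) ^ n)⁻¹ := by
    rw [← one_div, le_div_iff₀ h2n]; linarith
  have hn6 : ((2 : ℝ) ^ n)⁻¹ ≤ 6 * d := by
    rw [← one_div, div_le_iff₀ h2n]; rw [pow_succ] at hn2; linarith
  set v := z * (starRingEnd ℂ) w with hv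
  have hz0 : z ≠ 0 := by rintro rfl; simp at hzd; linarith
  have hw0 : w ≠ 0 := by rintro rfl; simp at hwd; linarith
  have hvn : 2 / 3 ≤ ‖v‖ := by
    have := norm_sub_norm_le 1 v
    rw [norm_one] at this
    linarith
  have hvre : 0 ≤ v.re := by
    have h1 := (Complex.re_le_norm (1 - v))
    simp only [Complex.sub_re, Complex.one_re] at h1
    linarith
  have hvim : |v.im| ≤ d := by
    have h1 := Complex.abs_im_le_norm (1 - v)
    simpa using h1
  have hδ : |v.arg| ≤ Real.pi / 2 * (d / (2 / 3)) := by
    refine (abs_arg_le_of_re_nonneg hvre).trans ?_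
    gcongr
  have hzexp : z = ‖z‖ * Complex.exp (((v.arg + w.arg : ℝ) : ℂ) * Complex.I) := by
    have hwn : (‖w‖ : ℂ) ≠ 0 := by simpa using hw0
    have h1 : (‖v‖ : ℂ) = ‖z‖ * ‖w‖ := by rw [hv, norm_mul, RCLike.norm_conj]; push_cast; rfl
    have h2 : (‖w‖ : ℂ) * ‖w‖ = w * (starRingEnd ℂ) w := by
      rw [Complex.mul_conj, Complex.normSq_eq_norm_sq]; push_cast; ring
    have hcw : (starRingEnd ℂ) w ≠ 0 := by simpa using hw0
    have h3 : (‖w‖ : ℂ) * ‖w‖ * (‖z‖ * Complex.exp (((v.arg + w.arg : ℝ) : ℂ) * Complex.I)) =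
        ‖w‖ * ‖w‖ * z := by
      calc (‖w‖ : ℂ) * ‖w‖ * (‖z‖ * Complex.exp (((v.arg + w.arg : ℝ) : ℂ) * Complex.I))
          = (‖v‖ * Complex.exp (v.arg * Complex.I)) * (‖w‖ * Complex.exp (w.arg * Complex.I)) := by
            rw [h1, Complex.ofReal_add, add_mul, Complex.exp_add]; ring
        _ = v * w := by rw [Complex.norm_mul_exp_arg_mul_I, Complex.norm_mul_exp_arg_mul_I]
        _ = ‖w‖ * ‖w‖ * z := by rw [h2, hv]; ring
    exact (mul_left_cancel₀ (mul_ne_zero hwn hwn) h3).symm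
  obtain ⟨m, hm⟩ := exists_arg_eq_of_eq_norm_mul_exp hz0 hzexp
  set η : ℝ := 2 ^ n * (v.arg / (2 * Real.pi)) with hη
  have hη6 : |η| < 1 / 6 := by
    rw [hη, abs_mul, abs_div, abs_of_pos h2n, abs_of_pos (by positivity : (0 : ℝ) < 2 * Real.pi)]
    calc 2 ^ n * (|v.arg| / (2 * Real.pi))
        ≤ 2 ^ n * (Real.pi / 2 * (d / (2 / 3)) / (2 * Real.pi)) := by gcongr
      _ = (2 ^ n * d) * (3 / 8) := by field_simp; norm_num
      _ < 1 / 6 := by linarith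
  have hpos : ∀ α : ℝ, ⌊2 ^ n * (w.arg / (2 * Real.pi)) - 2 ^ n * α + η⌋ =
      ⌊2 ^ n * (w.arg / (2 * Real.pi)) - 2 ^ n * α⌋ →
      ⌊2 ^ n * gridPos α z⌋₊ = ⌊2 ^ n * gridPos α w⌋₊ := by
    intro α hα
    have h1 : gridPos α z = Int.fract (w.arg / (2 * Real.pi) - α + v.arg / (2 * Real.pi)) := by
      rw [gridPos, hm,
        ← Int.fract_add_intCast (w.arg / (2 * Real.pi) - α + v.arg / (2 * Real.pi)) m]
      congr 1
      field_simp
      ring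
    rw [h1, gridPos]
    refine floor_two_pow_mul_fract_congr ?_
    rw [mul_add, mul_sub, hα]
  obtain ⟨α, hα, hfl⟩ : ∃ α : ℝ, (α = 0 ∨ α = 1 / 3) ∧
      ⌊2 ^ n * gridPos α z⌋₊ = ⌊2 ^ n * gridPos α w⌋₊ := by
    rcases floor_eq_or_floor_sub_third_eq (n := n) (y := 2 ^ n * (w.arg / (2 * Real.pi))) hη6
      with h | h
    · exact ⟨0, Or.inl rfl, hpos 0 (by simpa using h)⟩
    · exact ⟨1 / 3, Or.inr rfl, hpos (1 / 3) (by rw [mul_one_div]; exact h)⟩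
  exact ⟨α, hα, (n, ⌊2 ^ n * gridPos α w⌋₊), ⟨hz, hzd.trans hdn, hfl⟩, ⟨hw, hwd.trans hdn, rfl⟩, hn6⟩

/-! ### Change of variables for holomorphic maps -/

section ChangeOfVariables

variable {s : Set ℂ} {f f' : ℂ → ℂ}

theorem HasDerivAt.hasFDerivWithinAt_real {f : ℂ → ℂ} {f' z : ℂ} (h : HasDerivAt f f' z) (s : Set ℂ) :
    HasFDerivWithinAt f ((ContinuousLinearMap.toSpanSingleton ℂ f').restrictScalars ℝ) s z :=
  (h.hasFDerivAt.restrictScalars ℝ).hasFDerivWithinAt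

/-- The real determinant of multiplication by c is the field norm of c from ℂ to ℝ. -/
theorem abs_det_restrictScalars_toSpanSingleton (c : ℂ) :
    |((ContinuousLinearMap.toSpanSingleton ℂ c).restrictScalars ℝ : ℂ →L[ℝ] ℂ).det| = ‖c‖ ^ 2 := by
  have h : ((ContinuousLinearMap.toSpanSingleton ℂ c : ℂ →L[ℂ] ℂ) : ℂ →ₗ[ℂ] ℂ).det = c := by
    simp
  rw [ContinuousLinearMap.det, ContinuousLinearMap.coe_restrictScalars,
    LinearMap.det_restrictScalars, h, Algebra.norm_complex_eq]
  simp [Complex.normSq_eq_norm_sq]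

theorem lintegral_image_eq_lintegral_norm_deriv_sq_mul (hs : MeasurableSet s)
    (hf : ∀ z ∈ s, HasDerivAt f (f' z) z) (hinj : InjOn f s) (g : ℂ → ℝ≥0∞) :
    ∫⁻ w in f '' s, g w = ∫⁻ z in s, ENNReal.ofReal (‖f' z‖ ^ 2) * g (f z) := by
  rw [lintegral_image_eq_lintegral_abs_det_fderiv_mul volume hs
    (fun z hz => (hf z hz).hasFDerivWithinAt_real s) hinj]
  simp only [abs_det_restrictScalars_toSpanSingleton]

theorem integral_image_eq_integral_norm_deriv_sq_smul (hs : MeasurableSet s)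
    (hf : ∀ z ∈ s, HasDerivAt f (f' z) z) (hinj : InjOn f s) (g : ℂ → ℂ) :
    ∫ w in f '' s, g w = ∫ z in s, (‖f' z‖ ^ 2) • g (f z) := by
  rw [integral_image_eq_integral_abs_det_fderiv_smul volume hs
    (fun z hz => (hf z hz).hasFDerivWithinAt_real s) hinj]
  simp only [abs_det_restrictScalars_toSpanSingleton]

theorem integrableOn_image_iff_integrableOn_norm_deriv_sq_smul (hs : MeasurableSet s)
    (hf : ∀ z ∈ s, HasDerivAt f (f' z) z) (hinj : InjOn f s) (g : ℂ → ℂ) :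
    IntegrableOn g (f '' s) ↔ IntegrableOn (fun z => (‖f' z‖ ^ 2) • g (f z)) s := by
  rw [integrableOn_image_iff_integrableOn_abs_det_fderiv_smul volume hs
    (fun z hz => (hf z hz).hasFDerivWithinAt_real s) hinj]
  simp only [abs_det_restrictScalars_toSpanSingleton]

theorem volume_image_eq_lintegral_norm_deriv_sq (hs : MeasurableSet s)
    (hf : ∀ z ∈ s, HasDerivAt f (f' z) z) (hinj : InjOn f s) :
    volume (f '' s) = ∫⁻ z in s, ENNReal.ofReal (‖f' z‖ ^ 2) := by
  have := lintegral_image_eq_lintegral_norm_deriv_sq_mul hs hf hinj fun _ => 1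
  simpa using this

theorem volume_image_eq_zero_of_hasDerivAt
    (hf : ∀ z ∈ s, HasDerivAt f (f' z) z) (hs : volume s = 0) : volume (f '' s) = 0 :=
  addHaar_image_eq_zero_of_differentiableOn_of_addHaar_eq_zero volume
    (fun z hz => ((hf z hz).hasFDerivWithinAt_real s).differentiableWithinAt) hs

end ChangeOfVariables

/-! ### The mean value property on the unit disc -/

/-- Polar coordinates and the mean value property on each circle of radius less than 1.
Integrability suffices; no regularity at the boundary is needed. -/
theorem integral_ball_eq_pi_mul {g : ℂ → ℂ} (hg : DifferentiableOn ℂ g (ball 0 1))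
    (hi : IntegrableOn g (ball 0 1)) : ∫ z in ball (0 : ℂ) 1, g z = Real.pi * g 0 := by
  classical
  set G : ℂ → ℂ := (ball (0 : ℂ) 1).indicator g with hG
  have hGm : Measurable G := by
    have : Measurable ((ball (0 : ℂ) 1).piecewise g 0) :=
      hg.continuousOn.measurable_piecewise continuousOn_const measurableSet_ball
    rwa [Set.piecewise_eq_indicator] at this
  have hGi : Integrable G := (integrable_indicator_iff measurableSet_ball).2 hi
  set P : ℝ × ℝ → ℂ := fun p => p.1 • G (Complex.polarCoord.symm p) with hP
  have hPm : Measurable P := by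
    simp only [hP, Complex.polarCoord_symm_apply]
    refine measurable_fst.smul (hGm.comp ?_)
    fun_prop
  have hPi : IntegrableOn P (Ioi (0 : ℝ) ×ˢ Ioo (-Real.pi) Real.pi) := by
    refine ⟨hPm.aestronglyMeasurable, ?_⟩
    have h1 := Complex.lintegral_comp_polarCoord_symm fun z => ‖G z‖ₑ
    rw [polarCoord_target] at h1
    have h2 : ∫⁻ p in Ioi (0 : ℝ) ×ˢ Ioo (-Real.pi) Real.pi, ‖P p‖ₑ = ∫⁻ z, ‖G z‖ₑ := by
      rw [← h1]
      refine setLIntegral_congr_fun (measurableSet_Ioi.prod measurableSet_Ioo) fun p hp => ?_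
      have hp1 : 0 < p.1 := hp.1
      simp only [hP, enorm_smul, smul_eq_mul]
      rw [Real.enorm_eq_ofReal hp1.le]
    rw [HasFiniteIntegral, h2]
    exact hGi.2
  have hcirc : ∀ r ∈ Ioi (0 : ℝ), ∫ θ in Ioo (-Real.pi) Real.pi, P (r, θ) =
      (Iio (1 : ℝ)).indicator (fun r => r • ((2 * Real.pi) • g 0)) r := by
    intro r hr
    have hr0 : (0 : ℝ) < r := hr
    have hc : ∀ θ : ℝ, Complex.polarCoord.symm (r, θ) = circleMap 0 r θ := fun θ => by
      rw [circleMap, Complex.exp_mul_I]; simp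
    have hn : ∀ θ : ℝ, ‖circleMap 0 r θ‖ = r := fun θ => by simp [abs_of_pos hr0]
    simp only [hP, hc]
    by_cases h1 : r < 1
    · rw [indicator_of_mem (by exact h1)]
      have hmem : ∀ θ : ℝ, circleMap 0 r θ ∈ ball (0 : ℂ) 1 := fun θ => by
        rw [mem_ball_zero_iff, hn]; exact h1
      simp only [hG, indicator_of_mem (hmem _)]
      rw [integral_smul]
      congr 1
      have hd : DiffContOnCl ℂ g (ball 0 |r|) := by
        refine DifferentiableOn.diffContOnCl (hg.mono ?_)
        rw [abs_of_pos hr0]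
        exact closure_ball_subset_closedBall.trans (closedBall_subset_ball h1)
      have hav := hd.circleAverage
      rw [Real.circleAverage_eq_integral_add (-Real.pi),
        intervalIntegral.integral_comp_add_right (fun θ => g (circleMap 0 r θ))] at hav
      rw [← hav, smul_smul, mul_inv_cancel₀ (by positivity), one_smul,
        ← integral_Ioc_eq_integral_Ioo, ← intervalIntegral.integral_of_le (by linarith [Real.pi_pos])]
      congr 1 <;> ring
    · rw [indicator_of_notMem (by exact h1)]
      have hmem : ∀ θ : ℝ, circleMap 0 r θ ∉ ball (0 : ℂ) 1 := fun θ => by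
        rw [mem_ball_zero_iff, hn]; exact h1
      simp only [hG, indicator_of_notMem (hmem _)]
      simp
  calc ∫ z in ball (0 : ℂ) 1, g z = ∫ z, G z := (integral_indicator measurableSet_ball).symm
    _ = ∫ p in Ioi (0 : ℝ) ×ˢ Ioo (-Real.pi) Real.pi, P p := by
      rw [← Complex.integral_comp_polarCoord_symm, polarCoord_target]
    _ = ∫ r in Ioi (0 : ℝ), ∫ θ in Ioo (-Real.pi) Real.pi, P (r, θ) := by
      rw [Measure.volume_eq_prod] at hPi ⊢
      exact setIntegral_prod P hPi
    _ = ∫ r in Ioi (0 : ℝ), (Iio (1 : ℝ)).indicator (fun r => r • ((2 * Real.pi) • g 0)) r :=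
      setIntegral_congr_fun measurableSet_Ioi hcirc
    _ = ∫ r in (0 : ℝ)..1, r • ((2 * Real.pi) • g 0) := by
      rw [setIntegral_indicator measurableSet_Iio, Ioi_inter_Iio, ← integral_Ioc_eq_integral_Ioo,
        intervalIntegral.integral_of_le zero_le_one]
    _ = Real.pi * g 0 := by
      rw [intervalIntegral.integral_smul_const, integral_id]
      simp only [Complex.real_smul]
      push_cast
      ring

/-! ### The Bergman kernel and conformal maps -/

section Conformal

variable {ψ : ℂ → ℂ} {Ω : TopologicalSpace.Opens ℂ}

namespace IsConformalOnto

theorem hasDerivAt (hψ : IsConformalOnto ψ Ω) {z : ℂ} (hz : z ∈ ball (0 : ℂ) 1) :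
    HasDerivAt ψ (deriv ψ z) z :=
  (hψ.differentiableOn.differentiableAt (isOpen_ball.mem_nhds hz)).hasDerivAt

theorem mem (hψ : IsConformalOnto ψ Ω) {z : ℂ} (hz : z ∈ ball (0 : ℂ) 1) : ψ z ∈ Ω := by
  have : ψ z ∈ ψ '' ball 0 1 := mem_image_of_mem ψ hz
  rwa [hψ.image_eq] at this

theorem exists_eq (hψ : IsConformalOnto ψ Ω) {w : ℂ} (hw : w ∈ Ω) :
    ∃ z ∈ ball (0 : ℂ) 1, ψ z = w := by
  have : w ∈ ψ '' ball 0 1 := by rw [hψ.image_eq]; exact hw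
  exact this

theorem measurableSet_image (hψ : IsConformalOnto ψ Ω) {s : Set ℂ} (hs : MeasurableSet s)
    (hsub : s ⊆ ball 0 1) : MeasurableSet (ψ '' s) :=
  hs.image_of_continuousOn_injOn (hψ.differentiableOn.continuousOn.mono hsub) (hψ.injOn.mono hsub)

theorem image_subset (hψ : IsConformalOnto ψ Ω) {s : Set ℂ} (hsub : s ⊆ ball 0 1) :
    ψ '' s ⊆ Ω := by
  rw [← hψ.image_eq]; exact image_mono hsub

/-- A conformal map with nonvanishing derivative has a holomorphic inverse. -/
theorem exists_inverse (hψ : IsConformalOnto ψ Ω) (hd : ∀ z ∈ ball (0 : ℂ) 1, deriv ψ z ≠ 0) :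
    ∃ φ : ℂ → ℂ, (∀ z ∈ ball (0 : ℂ) 1, φ (ψ z) = z) ∧
      (∀ w ∈ Ω, φ w ∈ ball (0 : ℂ) 1 ∧ ψ (φ w) = w) ∧ DifferentiableOn ℂ φ Ω := by
  set φ := Function.invFunOn ψ (ball 0 1)
  have h1 : ∀ z ∈ ball (0 : ℂ) 1, φ (ψ z) = z := fun z hz => hψ.injOn.leftInvOn_invFunOn hz
  have h2 : ∀ w ∈ Ω, φ w ∈ ball (0 : ℂ) 1 ∧ ψ (φ w) = w := fun w hw =>
    ⟨Function.invFunOn_mem (hψ.exists_eq hw), Function.invFunOn_eq (hψ.exists_eq hw)⟩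
  refine ⟨φ, h1, h2, fun w hw => ?_⟩
  obtain ⟨z, hz, rfl⟩ := hψ.exists_eq hw
  have hs : HasStrictDerivAt ψ (deriv ψ z) z :=
    -- Where the derivative does not vanish, ψ maps the neighborhood filter of z onto that of ψ z,
    -- which makes the inverse continuous there.
    (hψ.differentiableOn.analyticAt (isOpen_ball.mem_nhds hz)).hasStrictDerivAt
  have hc : ContinuousAt φ (ψ z) := by
    rw [ContinuousAt, h1 z hz, ← hs.map_nhds_eq (hd z hz), tendsto_map'_iff]
    refine tendsto_id.congr' ?_
    filter_upwards [isOpen_ball.mem_nhds hz] with y hy using (h1 y hy).symm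
  have hev : ∀ᶠ y in 𝓝 (ψ z), ψ (φ y) = y := by
    filter_upwards [Ω.isOpen.mem_nhds hw] with y hy using (h2 y hy).2
  have hz' : HasDerivAt ψ (deriv ψ z) (φ (ψ z)) := by rw [h1 z hz]; exact hψ.hasDerivAt hz
  exact (HasDerivAt.of_local_left_inverse hc hz' (hd z hz)
    hev).differentiableAt.differentiableWithinAt

/-- With φ the inverse of ψ, the function h = c / (ψ' ∘ φ) represents evaluation at ψ(0). Pulled
back to the disc, ∫ F conj(h) becomes (π ψ'(0))⁻¹ ∫ (F ∘ ψ) ψ', which is F(ψ(0)) by the mean value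
property. The kernel of the disc is never needed separately. -/
theorem bergmanKernel_zero (hψ : IsConformalOnto ψ Ω) (hd : ∀ z ∈ ball (0 : ℂ) 1, deriv ψ z ≠ 0)
    {z : ℂ} (hz : z ∈ ball (0 : ℂ) 1) :
    bergmanKernel Ω (ψ 0) (ψ z) = (Real.pi * (deriv ψ 0 * (starRingEnd ℂ) (deriv ψ z)))⁻¹ := by
  have h0 : (0 : ℂ) ∈ ball (0 : ℂ) 1 := mem_ball_self one_pos
  obtain ⟨φ, hφ1, hφ2, hφ⟩ := hψ.exists_inverse hd
  have hdd : DifferentiableOn ℂ (deriv ψ) (ball 0 1) := hψ.differentiableOn.deriv isOpen_ball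
  set c : ℂ := (starRingEnd ℂ) (Real.pi * deriv ψ 0)⁻¹ with hc
  set h : ℂ → ℂ := fun w => c / deriv ψ (φ w) with hh
  have hhd : DifferentiableOn ℂ h Ω :=
    (differentiableOn_const c).div (hdd.comp hφ fun w hw => (hφ2 w hw).1)
      fun w hw => hd _ (hφ2 w hw).1
  have hder : ∀ z ∈ ball (0 : ℂ) 1, HasDerivAt ψ (deriv ψ z) z := fun z hz => hψ.hasDerivAt hz
  have hhL : MemLp h 2 (volume.restrict (Ω : Set ℂ)) := by
    refine ⟨hhd.continuousOn.aestronglyMeasurable Ω.isOpen.measurableSet, ?_⟩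
    -- The Jacobian |ψ'|² cancels the denominator, so |h|² pulls back to the constant |c|².
    have h1 : ∫⁻ w in (Ω : Set ℂ), ‖h w‖ₑ ^ 2 = ‖c‖ₑ ^ 2 * volume (ball (0 : ℂ) 1) := by
      rw [← hψ.image_eq, lintegral_image_eq_lintegral_norm_deriv_sq_mul measurableSet_ball hder
        hψ.injOn, ← setLIntegral_const]
      refine setLIntegral_congr_fun measurableSet_ball fun z hz => ?_
      simp only [hh]
      rw [hφ1 z hz, ENNReal.ofReal_pow (norm_nonneg _), ofReal_norm, ← mul_pow,
        ← enorm_mul, mul_div_cancel₀ _ (hd z hz)]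
    rw [lintegral_enorm_sq_eq_eLpNorm_sq] at h1
    have h2 : ‖c‖ₑ ^ 2 * volume (ball (0 : ℂ) 1) < ∞ :=
      ENNReal.mul_lt_top (by finiteness) measure_ball_lt_top
    rw [← h1] at h2
    by_contra hcon
    rw [not_lt_top_iff.1 hcon] at h2
    simp at h2
  have hHae := hhL.coeFn_toLp
  set H : bergmanSpace Ω := ⟨hhL.toLp h, h, hhd, hHae⟩ with hH
  have hmem : ψ 0 ∈ Ω := hψ.mem h0
  have hdual : (InnerProductSpace.toDual ℂ (bergmanSpace Ω)).symm (bergmanEval Ω ⟨ψ 0, hmem⟩) = H := by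
    rw [LinearIsometryEquiv.symm_apply_eq]
    refine ContinuousLinearMap.ext fun F => ?_
    rw [InnerProductSpace.toDual_apply_apply]
    change holoRep F (ψ 0) = inner ℂ (hhL.toLp h) (F : Lp ℂ 2 (volume.restrict (Ω : Set ℂ)))
    have hint : IntegrableOn (fun w => holoRep F w * (starRingEnd ℂ) (h w)) (Ω : Set ℂ) := by
      refine (L2.integrable_inner (𝕜 := ℂ) (hhL.toLp h)
        (F : Lp ℂ 2 (volume.restrict (Ω : Set ℂ)))).congr ?_
      filter_upwards [hHae, holoRep_ae F] with w hw1 hw2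
      rw [RCLike.inner_apply, hw1, hw2]
    have hinner : inner ℂ (hhL.toLp h) (F : Lp ℂ 2 (volume.restrict (Ω : Set ℂ))) =
        ∫ w in (Ω : Set ℂ), holoRep F w * (starRingEnd ℂ) (h w) := by
      rw [L2.inner_def]
      refine integral_congr_ae ?_
      filter_upwards [hHae, holoRep_ae F] with w hw1 hw2
      rw [RCLike.inner_apply, hw1, hw2]
    have hpt : ∀ z ∈ ball (0 : ℂ) 1, (‖deriv ψ z‖ ^ 2) •
        (holoRep F (ψ z) * (starRingEnd ℂ) (h (ψ z))) =
        (Real.pi * deriv ψ 0)⁻¹ * (holoRep F (ψ z) * deriv ψ z) := by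
      intro z hz
      have h1 : ((‖deriv ψ z‖ ^ 2 : ℝ) : ℂ) = deriv ψ z * (starRingEnd ℂ) (deriv ψ z) := by
        rw [Complex.mul_conj, Complex.normSq_eq_norm_sq]
      have h2 : (starRingEnd ℂ) (deriv ψ z) ≠ 0 := by simpa using hd z hz
      simp only [hh]
      rw [hφ1 z hz, Complex.real_smul, h1, map_div₀, hc, Complex.conj_conj]
      field_simp
    rw [hinner]
    rw [← hψ.image_eq, integrableOn_image_iff_integrableOn_norm_deriv_sq_smul measurableSet_ball
      hder hψ.injOn, integrableOn_congr_fun hpt measurableSet_ball] at hint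
    rw [← hψ.image_eq, integral_image_eq_integral_norm_deriv_sq_smul measurableSet_ball
      hder hψ.injOn, setIntegral_congr_fun measurableSet_ball hpt, integral_ball_eq_pi_mul ?_ hint]
    · have := hd 0 h0
      have hpi : (Real.pi : ℂ) ≠ 0 := by exact_mod_cast Real.pi_ne_zero
      field_simp
    · refine (differentiableOn_const _).mul (DifferentiableOn.mul ?_ hdd)
      exact (holoRep_differentiableOn F).comp hψ.differentiableOn fun z hz => hψ.mem hz
  have heq : EqOn (holoRep H) h Ω :=
    holomorphic_eq_of_ae (holoRep_differentiableOn H) hhd ((holoRep_ae H).symm.trans hHae)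
  rw [bergmanKernel, dif_pos hmem, hdual, heq (hψ.mem hz)]
  simp only [hh]
  rw [hφ1 z hz, map_div₀, hc, Complex.conj_conj]
  simp only [mul_inv, div_eq_mul_inv]
  ring

end IsConformalOnto

/-! ### Automorphisms of the disc -/

/-- The involutive automorphism of the unit disc that interchanges `0` and `a`. -/
noncomputable def discInvolution (a z : ℂ) : ℂ := (a - z) / (1 - (starRingEnd ℂ) a * z)

theorem one_sub_conj_mul_ne_zero {a z : ℂ} (ha : a ∈ ball (0 : ℂ) 1) (hz : z ∈ ball (0 : ℂ) 1) :
    1 - (starRingEnd ℂ) a * z ≠ 0 := by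
  rw [mem_ball_zero_iff] at ha hz
  intro h
  have h1 : ‖(starRingEnd ℂ) a * z‖ = 1 := by rw [← sub_eq_zero.1 h, norm_one]
  rw [norm_mul, RCLike.norm_conj] at h1
  nlinarith [norm_nonneg a, norm_nonneg z]

theorem discInvolution_mem_ball {a z : ℂ} (ha : a ∈ ball (0 : ℂ) 1) (hz : z ∈ ball (0 : ℂ) 1) :
    discInvolution a z ∈ ball (0 : ℂ) 1 := by
  have hne := one_sub_conj_mul_ne_zero ha hz
  rw [mem_ball_zero_iff] at ha hz ⊢
  rw [discInvolution, norm_div, div_lt_one (norm_pos_iff.2 hne)]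
  refine lt_of_pow_lt_pow_left₀ 2 (norm_nonneg _) ?_
  have h1 : ‖1 - (starRingEnd ℂ) a * z‖ ^ 2 - ‖a - z‖ ^ 2 = (1 - ‖a‖ ^ 2) * (1 - ‖z‖ ^ 2) := by
    simp only [← Complex.normSq_eq_norm_sq, Complex.normSq_apply]
    simp
    ring
  have h2 : 0 < (1 - ‖a‖ ^ 2) * (1 - ‖z‖ ^ 2) := by
    apply mul_pos <;> nlinarith [norm_nonneg a, norm_nonneg z]
  linarith

theorem one_sub_conj_mul_discInvolution {a z : ℂ} (ha : a ∈ ball (0 : ℂ) 1)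
    (hz : z ∈ ball (0 : ℂ) 1) : 1 - (starRingEnd ℂ) a * discInvolution a z =
      (1 - (starRingEnd ℂ) a * a) / (1 - (starRingEnd ℂ) a * z) := by
  have hne := one_sub_conj_mul_ne_zero ha hz
  rw [discInvolution]
  field_simp
  ring

theorem discInvolution_discInvolution {a z : ℂ} (ha : a ∈ ball (0 : ℂ) 1)
    (hz : z ∈ ball (0 : ℂ) 1) : discInvolution a (discInvolution a z) = z := by
  have hne := one_sub_conj_mul_ne_zero ha hz
  have hne' := one_sub_conj_mul_ne_zero ha ha
  nth_rewrite 1 [discInvolution]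
  rw [one_sub_conj_mul_discInvolution ha hz, discInvolution, div_div_eq_mul_div,
    div_eq_iff hne', sub_mul, div_mul_cancel₀ _ hne]
  ring

theorem hasDerivAt_discInvolution {a z : ℂ} (ha : a ∈ ball (0 : ℂ) 1) (hz : z ∈ ball (0 : ℂ) 1) :
    HasDerivAt (discInvolution a)
      (-(1 - (starRingEnd ℂ) a * a) / (1 - (starRingEnd ℂ) a * z) ^ 2) z := by
  have hne := one_sub_conj_mul_ne_zero ha hz
  have h1 : HasDerivAt (fun z => a - z) (-1) z := (hasDerivAt_id z).const_sub a
  have h2 : HasDerivAt (fun z => 1 - (starRingEnd ℂ) a * z) (-(starRingEnd ℂ) a) z := by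
    simpa using ((hasDerivAt_id z).const_mul ((starRingEnd ℂ) a)).const_sub 1
  have h3 := h1.div h2 hne
  refine HasDerivAt.congr_deriv h3 ?_
  congr 1
  ring

namespace IsConformalOnto

theorem comp_discInvolution (hψ : IsConformalOnto ψ Ω) {a : ℂ} (ha : a ∈ ball (0 : ℂ) 1) :
    IsConformalOnto (ψ ∘ discInvolution a) Ω where
  differentiableOn := hψ.differentiableOn.comp
    (fun z hz => (hasDerivAt_discInvolution ha hz).differentiableAt.differentiableWithinAt)
    fun z hz => discInvolution_mem_ball ha hz
  injOn := by
    intro z hz w hw h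
    have h1 := hψ.injOn (discInvolution_mem_ball ha hz) (discInvolution_mem_ball ha hw) h
    rw [← discInvolution_discInvolution ha hz, h1, discInvolution_discInvolution ha hw]
  image_eq := by
    rw [← hψ.image_eq, image_comp]
    congr 1
    refine Subset.antisymm ?_ fun z hz => ⟨_, discInvolution_mem_ball ha hz,
      discInvolution_discInvolution ha hz⟩
    rintro _ ⟨z, hz, rfl⟩
    exact discInvolution_mem_ball ha hz

/-- The transformation rule for the Bergman kernel under a conformal map. -/
theorem bergmanKernel_eq (hψ : IsConformalOnto ψ Ω) (hd : ∀ z ∈ ball (0 : ℂ) 1, deriv ψ z ≠ 0)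
    {z w : ℂ} (hz : z ∈ ball (0 : ℂ) 1) (hw : w ∈ ball (0 : ℂ) 1) :
    bergmanKernel Ω (ψ z) (ψ w) = (Real.pi * (deriv ψ z * (starRingEnd ℂ) (deriv ψ w) *
      (1 - z * (starRingEnd ℂ) w) ^ 2))⁻¹ := by
  have h0 : (0 : ℂ) ∈ ball (0 : ℂ) 1 := mem_ball_self one_pos
  have hder : ∀ x ∈ ball (0 : ℂ) 1, deriv (ψ ∘ discInvolution z) x =
      deriv ψ (discInvolution z x) *
        (-(1 - (starRingEnd ℂ) z * z) / (1 - (starRingEnd ℂ) z * x) ^ 2) := fun x hx =>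
    ((hψ.hasDerivAt (discInvolution_mem_ball hz hx)).comp x
      (hasDerivAt_discInvolution hz hx)).deriv
  have hne := one_sub_conj_mul_ne_zero hz hz
  have hd' : ∀ x ∈ ball (0 : ℂ) 1, deriv (ψ ∘ discInvolution z) x ≠ 0 := fun x hx => by
    rw [hder x hx]
    exact mul_ne_zero (hd _ (discInvolution_mem_ball hz hx))
      (div_ne_zero (neg_ne_zero.2 hne) (pow_ne_zero 2 (one_sub_conj_mul_ne_zero hz hx)))
  have hw' := discInvolution_mem_ball hz hw
  -- Precomposing with the involution that sends 0 to z reduces the general formula to the case of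
  -- base point 0.
  have key := (hψ.comp_discInvolution hz).bergmanKernel_zero hd' hw'
  have hz0 : discInvolution z 0 = z := by simp [discInvolution]
  have hnw := one_sub_conj_mul_ne_zero hz hw
  have hnw' : 1 - z * (starRingEnd ℂ) w ≠ 0 := by
    have := (map_ne_zero (starRingEnd ℂ)).2 hnw
    simpa using this
  have hreal : (starRingEnd ℂ) (1 - (starRingEnd ℂ) z * z) = 1 - (starRingEnd ℂ) z * z := by
    simp [mul_comm]
  rw [Function.comp_apply, Function.comp_apply, discInvolution_discInvolution hz hw, hz0, hder 0 h0,
    hder _ hw', hz0, discInvolution_discInvolution hz hw, one_sub_conj_mul_discInvolution hz hw] at key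
  rw [key]
  congr 2
  have hconj : (starRingEnd ℂ) (1 - (starRingEnd ℂ) z * w) = 1 - z * (starRingEnd ℂ) w := by simp
  simp only [map_mul, map_div₀, map_neg, map_pow, hreal, hconj]
  field_simp
  simp

end IsConformalOnto

end Conformal

/-! ### Consequences of the `B₁` conditions on dyadic boxes -/

theorem lintegral_mul_eLpNorm_inv_le_b1Char {ψ : ℂ → ℂ} (σ : ℂ → ℝ) (θ₀ : ℝ) {ℓ : ℝ}
    (hℓ : 0 < ℓ ∧ ℓ ≤ 1) (h0 : volume (ψ '' carlesonBox θ₀ ℓ) ≠ 0)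
    (htop : volume (ψ '' carlesonBox θ₀ ℓ) ≠ ∞) :
    (∫⁻ z in ψ '' carlesonBox θ₀ ℓ, ENNReal.ofReal (σ z)) *
        eLpNorm (fun z => (σ z)⁻¹) ∞ (volume.restrict (ψ '' carlesonBox θ₀ ℓ)) ≤
      b1Char ψ σ * volume (ψ '' carlesonBox θ₀ ℓ) := by
  have h : weightAverage σ (ψ '' carlesonBox θ₀ ℓ) *
      eLpNorm (fun z => (σ z)⁻¹) ∞ (volume.restrict (ψ '' carlesonBox θ₀ ℓ)) ≤ b1Char ψ σ :=
    le_iSup₂_of_le θ₀ ℓ (le_iSup_of_le hℓ le_rfl)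
  have h1 : (∫⁻ z in ψ '' carlesonBox θ₀ ℓ, ENNReal.ofReal (σ z)) =
      weightAverage σ (ψ '' carlesonBox θ₀ ℓ) * volume (ψ '' carlesonBox θ₀ ℓ) :=
    (ENNReal.div_mul_cancel h0 htop).symm
  rw [h1, mul_right_comm]
  gcongr

/-- Multiply g by 1 = σ⁻¹ σ and bound σ⁻¹ by its essential supremum. -/
theorem setLIntegral_le_eLpNorm_inv_mul {E : Set ℂ} {σ : ℂ → ℝ}
    (hσ : ∀ᵐ z ∂(volume.restrict E), 0 < σ z) {n : ℝ≥0∞}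
    (hn : eLpNorm (fun z => (σ z)⁻¹) ∞ (volume.restrict E) ≤ n) (hn' : n ≠ ∞) (g : ℂ → ℝ≥0∞) :
    ∫⁻ z in E, g z ≤ n * ∫⁻ z in E, ENNReal.ofReal (σ z) * g z := by
  rw [← lintegral_const_mul' _ _ hn']
  rw [eLpNorm_exponent_top] at hn
  refine lintegral_mono_ae ?_
  filter_upwards [hσ, enorm_ae_le_eLpNormEssSup (fun z => (σ z)⁻¹) (volume.restrict E)] with z hz hz'
  have h1 : ‖(σ z)⁻¹‖ₑ * ENNReal.ofReal (σ z) = 1 := by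
    rw [Real.enorm_eq_ofReal (by positivity), ← ENNReal.ofReal_mul (by positivity),
      inv_mul_cancel₀ hz.ne', ENNReal.ofReal_one]
  calc g z = ‖(σ z)⁻¹‖ₑ * ENNReal.ofReal (σ z) * g z := by rw [h1, one_mul]
    _ ≤ n * ENNReal.ofReal (σ z) * g z := by gcongr; exact hz'.trans hn
    _ = n * (ENNReal.ofReal (σ z) * g z) := mul_assoc _ _ _

theorem setLIntegral_ofReal_ne_zero {E : Set ℂ} {σ : ℂ → ℝ}
    (hσm : AEMeasurable σ (volume.restrict E)) (hσ : ∀ᵐ z ∂(volume.restrict E), 0 < σ z)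
    (hE : volume E ≠ 0) : ∫⁻ z in E, ENNReal.ofReal (σ z) ≠ 0 := by
  intro h
  rw [lintegral_eq_zero_iff' hσm.ennreal_ofReal] at h
  have : ∀ᵐ z ∂(volume.restrict E), False := by
    filter_upwards [h, hσ] with z hz hz'
    have h1 : ENNReal.ofReal (σ z) = 0 := hz
    exact absurd (ENNReal.ofReal_eq_zero.1 h1) (not_le.2 hz')
  rw [eventually_false_iff_eq_bot, ae_eq_bot, Measure.restrict_eq_zero] at this
  exact hE this

/-- The Carleson box that contains a dyadic box. -/
def carlesonHull (α : ℝ) (p : ℕ × ℕ) : Set ℂ := carlesonBox (gridCenter α p) ((2 : ℝ) ^ p.1)⁻¹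

theorem inv_two_pow_pos_and_le_one (n : ℕ) : 0 < ((2 : ℝ) ^ n)⁻¹ ∧ ((2 : ℝ) ^ n)⁻¹ ≤ 1 :=
  ⟨by positivity, inv_le_one_of_one_le₀ (one_le_pow₀ (by norm_num))⟩

theorem carlesonHull_subset_ball (α : ℝ) (p : ℕ × ℕ) : carlesonHull α p ⊆ ball 0 1 :=
  carlesonBox_subset_ball_zero _ _

theorem measurableSet_carlesonHull (α : ℝ) (p : ℕ × ℕ) : MeasurableSet (carlesonHull α p) :=
  measurableSet_carlesonBox _ _

theorem gridBox_subset_carlesonHull (α : ℝ) (p : ℕ × ℕ) : gridBox α p ⊆ carlesonHull α p :=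
  gridBox_subset_carlesonBox α p

theorem ball_subset_gridBox_zero : ball (0 : ℂ) 1 ⊆ gridBox 0 (0, 0) := fun z hz => by
  rw [mem_ball_zero_iff] at hz
  refine ⟨hz, by simp, ?_⟩
  rw [pow_zero, one_mul]
  exact Nat.floor_eq_zero.2 (Int.fract_lt_one _)

/-- The `B₁` conditions on this one box give the global facts: ψ' is bounded below, σ has finite
mass, and L¹(σ) embeds in L¹. -/
theorem carlesonHull_zero : carlesonHull 0 (0, 0) = ball 0 1 :=
  (carlesonHull_subset_ball _ _).antisymm
    (ball_subset_gridBox_zero.trans (gridBox_subset_carlesonHull _ _))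

theorem volume_gridTop_pos (α : ℝ) {p : ℕ × ℕ} (hp : p.2 < 2 ^ p.1) : 0 < volume (gridTop α p) := by
  have h := le_volume_gridTop α hp
  refine pos_iff_ne_zero.2 fun h0 => ?_
  rw [h0, mul_zero, nonpos_iff_eq_zero] at h
  have h1 := (inv_two_pow_pos_and_le_one p.1).1
  have h2 : 0 < ENNReal.ofReal ((2 : ℝ) ^ p.1)⁻¹ := ENNReal.ofReal_pos.2 h1
  exact (pow_ne_zero 2 h2.ne') h

theorem gridTop_subset_carlesonHull (α : ℝ) (p : ℕ × ℕ) : gridTop α p ⊆ carlesonHull α p :=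
  inter_subset_left.trans (gridBox_subset_carlesonHull α p)

/-- The essential supremum of `|ψ'|⁻²` over the hull of a dyadic box. -/
noncomputable def invDerivSup (ψ : ℂ → ℂ) (α : ℝ) (p : ℕ × ℕ) : ℝ≥0∞ :=
  eLpNorm (fun z => (‖deriv ψ z‖ ^ 2)⁻¹) ∞ (volume.restrict (carlesonHull α p))

/-- The essential supremum of `σ⁻¹` over the image of the hull of a dyadic box. -/
noncomputable def invWeightSup (ψ : ℂ → ℂ) (σ : ℂ → ℝ) (α : ℝ) (p : ℕ × ℕ) : ℝ≥0∞ :=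
  eLpNorm (fun z => (σ z)⁻¹) ∞ (volume.restrict (ψ '' carlesonHull α p))

namespace IsConformalOnto

variable {ψ : ℂ → ℂ} {Ω : TopologicalSpace.Opens ℂ}

theorem volume_ne_zero (hψ : IsConformalOnto ψ Ω) : volume (Ω : Set ℂ) ≠ 0 :=
  (Ω.isOpen.measure_pos volume ⟨ψ 0, hψ.mem (mem_ball_self one_pos)⟩).ne'

theorem volume_image (hψ : IsConformalOnto ψ Ω) {s : Set ℂ} (hs : MeasurableSet s)
    (hsub : s ⊆ ball 0 1) : volume (ψ '' s) = ∫⁻ z in s, ENNReal.ofReal (‖deriv ψ z‖ ^ 2) :=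
  volume_image_eq_lintegral_norm_deriv_sq hs (fun _ hz => hψ.hasDerivAt (hsub hz))
    (hψ.injOn.mono hsub)

/-- If `|ψ'|²` is a `B₁` weight, then `ψ'` is bounded away from zero. -/
theorem exists_pos_le_norm_deriv_sq (hψ : IsConformalOnto ψ Ω)
    (hU : b1Char id (fun z => ‖deriv ψ z‖ ^ 2) < ∞) :
    ∃ m : ℝ, 0 < m ∧ ∀ z ∈ ball (0 : ℂ) 1, m ≤ ‖deriv ψ z‖ ^ 2 := by
  have hball : carlesonBox (gridCenter 0 (0, 0)) ((2 : ℝ) ^ 0)⁻¹ = ball 0 1 := carlesonHull_zero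
  have hvb : volume (ball (0 : ℂ) 1) ≠ 0 := (measure_ball_pos volume 0 one_pos).ne'
  have hvb' : volume (ball (0 : ℂ) 1) ≠ ∞ := measure_ball_lt_top.ne
  have h1 := lintegral_mul_eLpNorm_inv_le_b1Char (ψ := id) (fun z => ‖deriv ψ z‖ ^ 2)
    (gridCenter 0 (0, 0)) (inv_two_pow_pos_and_le_one 0)
    (by rwa [hball, image_id]) (by rwa [hball, image_id])
  rw [hball, image_id] at h1
  set n := eLpNorm (fun z => (‖deriv ψ z‖ ^ 2)⁻¹) ∞ (volume.restrict (ball 0 1)) with hn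
  have hI : ∫⁻ z in ball (0 : ℂ) 1, ENNReal.ofReal (‖deriv ψ z‖ ^ 2) ≠ 0 := by
    rw [← hψ.volume_image measurableSet_ball subset_rfl, hψ.image_eq]
    exact hψ.volume_ne_zero
  have hnt : n ≠ ∞ := by
    intro h
    rw [h, ENNReal.mul_top hI, top_le_iff] at h1
    exact ENNReal.mul_ne_top hU.ne hvb' h1
  have hae : ∀ᵐ z ∂(volume.restrict (ball (0 : ℂ) 1)), (‖deriv ψ z‖ ^ 2)⁻¹ ≤ n.toReal := by
    have := enorm_ae_le_eLpNormEssSup (fun z => (‖deriv ψ z‖ ^ 2)⁻¹) (volume.restrict (ball (0 : ℂ) 1))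
    filter_upwards [this] with z hz
    rw [← eLpNorm_exponent_top, ← hn, Real.enorm_eq_ofReal (by positivity)] at hz
    exact (ENNReal.ofReal_le_iff_le_toReal hnt).1 hz
  have hn0 : 0 ≤ n.toReal := ENNReal.toReal_nonneg
  -- Adding 1 keeps `m` positive and makes its inverse strictly larger than the essential bound.
  set m : ℝ := (n.toReal + 1)⁻¹ with hm
  have hm0 : 0 < m := by positivity
  have hdd : DifferentiableOn ℂ (deriv ψ) (ball 0 1) := hψ.differentiableOn.deriv isOpen_ball
  have hcont : ContinuousOn (fun z => ‖deriv ψ z‖ ^ 2) (ball 0 1) := hdd.continuousOn.norm.pow 2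
  -- The set where 0 < |ψ'|² < m is open by continuity and null by the essential bound, hence empty.
  -- Zeros of ψ' have to be excluded separately, by the identity theorem.
  have hdich : ∀ z ∈ ball (0 : ℂ) 1, ‖deriv ψ z‖ ^ 2 < m → ‖deriv ψ z‖ ^ 2 = 0 := by
    intro z hz hzm
    by_contra h0
    have hpos : 0 < ‖deriv ψ z‖ ^ 2 := lt_of_le_of_ne (by positivity) (Ne.symm h0)
    have hV := hcont.isOpen_inter_preimage isOpen_ball (isOpen_Ioo (a := 0) (b := m))
    refine (hV.measure_pos volume ⟨z, hz, hpos, hzm⟩).ne' ?_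
    rw [ae_restrict_iff' measurableSet_ball] at hae
    refine measure_mono_null (fun y hy => ?_) hae
    intro hcon
    have h2 := hcon hy.1
    have h3 : ‖deriv ψ y‖ ^ 2 ∈ Ioo 0 m := hy.2
    have h4 : m⁻¹ < (‖deriv ψ y‖ ^ 2)⁻¹ := inv_strictAnti₀ h3.1 h3.2
    rw [hm, inv_inv] at h4
    linarith
  refine ⟨m, hm0, fun z hz => ?_⟩
  by_contra! hzm
  have hev : deriv ψ =ᶠ[𝓝 z] 0 := by
    filter_upwards [isOpen_ball.mem_nhds hz,
      (hcont.continuousAt (isOpen_ball.mem_nhds hz)).eventually_lt_const hzm] with y hy hym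
    simpa using hdich y hy hym
  -- Near z the derivative vanishes identically, so ψ' = 0 on the whole disc, which contradicts that
  -- Ω has positive area.
  have hzero := (hdd.analyticOnNhd isOpen_ball).eqOn_zero_of_preconnected_of_eventuallyEq_zero
    (convex_ball (0 : ℂ) 1).isPreconnected hz hev
  refine hI ?_
  rw [setLIntegral_congr_fun (g := fun _ => 0) measurableSet_ball fun y hy => by simp [hzero hy]]
  simp

theorem deriv_ne_zero (hψ : IsConformalOnto ψ Ω)
    (hU : b1Char id (fun z => ‖deriv ψ z‖ ^ 2) < ∞) : ∀ z ∈ ball (0 : ℂ) 1, deriv ψ z ≠ 0 := by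
  obtain ⟨m, hm, h⟩ := hψ.exists_pos_le_norm_deriv_sq hU
  intro z hz h0
  have := h z hz
  rw [h0] at this
  simp at this
  linarith

end IsConformalOnto

theorem IsWeightOn.aestronglyMeasurable {Ω : TopologicalSpace.Opens ℂ} {σ : ℂ → ℝ}
    (hσ : IsWeightOn Ω σ) : AEStronglyMeasurable σ (volume.restrict (Ω : Set ℂ)) :=
  hσ.locallyIntegrableOn.aestronglyMeasurable

/-! ### Estimates for boxes and their top halves under both `B₁` conditions -/

/-- The standing assumptions: a conformal map onto a domain of finite area with `|ψ'|²` in `B₁(𝔻)`,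
and a `B₁` weight on the domain. -/
structure IsB1Setting (ψ : ℂ → ℂ) (Ω : TopologicalSpace.Opens ℂ) (σ : ℂ → ℝ) : Prop where
  volume_ne_top : volume (Ω : Set ℂ) ≠ ∞
  conformal : IsConformalOnto ψ Ω
  deriv_lt_top : b1Char id (fun z => ‖deriv ψ z‖ ^ 2) < ∞
  weight : IsWeightOn Ω σ
  weight_lt_top : b1Char ψ σ < ∞

namespace IsB1Setting

variable {ψ : ℂ → ℂ} {Ω : TopologicalSpace.Opens ℂ} {σ : ℂ → ℝ}
  {α : ℝ} {p : ℕ × ℕ}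

theorem weight_pos (h : IsB1Setting ψ Ω σ) {s : Set ℂ} (hs : s ⊆ Ω) :
    ∀ᵐ z ∂(volume.restrict s), 0 < σ z :=
  ae_mono (Measure.restrict_mono hs le_rfl) h.weight.pos

theorem deriv_pos (h : IsB1Setting ψ Ω σ) {s : Set ℂ} (hsm : MeasurableSet s) (hs : s ⊆ ball 0 1) :
    ∀ᵐ z ∂(volume.restrict s), 0 < ‖deriv ψ z‖ ^ 2 := by
  filter_upwards [ae_restrict_mem hsm] with z hz
  have := h.conformal.deriv_ne_zero h.deriv_lt_top z (hs hz)
  positivity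

theorem weightMeasure_apply {s : Set ℂ} (hs : MeasurableSet s) (hsub : s ⊆ (Ω : Set ℂ)) :
    weightMeasure Ω σ s = ∫⁻ z in s, ENNReal.ofReal (σ z) := by
  rw [weightMeasure, withDensity_apply _ hs, Measure.restrict_restrict hs,
    inter_eq_self_of_subset_left hsub]

theorem volume_image_ne_top (h : IsB1Setting ψ Ω σ) {s : Set ℂ} (hs : s ⊆ ball 0 1) :
    volume (ψ '' s) ≠ ∞ :=
  ne_top_of_le_ne_top h.volume_ne_top (measure_mono (h.conformal.image_subset hs))

theorem volume_image_ne_zero (h : IsB1Setting ψ Ω σ) {s : Set ℂ} (hsm : MeasurableSet s)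
    (hs : s ⊆ ball 0 1) (h0 : volume s ≠ 0) : volume (ψ '' s) ≠ 0 := by
  rw [h.conformal.volume_image hsm hs]
  exact setLIntegral_ofReal_ne_zero ((measurable_deriv ψ).norm.pow_const 2).aemeasurable
    (h.deriv_pos hsm hs) h0

theorem volume_carlesonHull_ne_zero (hp : p.2 < 2 ^ p.1) : volume (carlesonHull α p) ≠ 0 :=
  fun h0 => (volume_gridTop_pos α hp).ne' (measure_mono_null (gridTop_subset_carlesonHull α p) h0)

/-- The area of the image is the integral of |ψ'|² over the hull, so this is the `B₁` condition for
|ψ'|² with the average cleared of its denominator. -/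
theorem volume_image_mul_invDerivSup_le (h : IsB1Setting ψ Ω σ) (hp : p.2 < 2 ^ p.1) :
    volume (ψ '' carlesonHull α p) * invDerivSup ψ α p ≤
      b1Char id (fun z => ‖deriv ψ z‖ ^ 2) * (100 * ENNReal.ofReal ((2 : ℝ) ^ p.1)⁻¹ ^ 2) := by
  have h1 := volume_carlesonBox_le (gridCenter α p) ((2 : ℝ) ^ p.1)⁻¹
  have h2 := lintegral_mul_eLpNorm_inv_le_b1Char (ψ := id) (fun z => ‖deriv ψ z‖ ^ 2)
    (gridCenter α p) (inv_two_pow_pos_and_le_one p.1)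
    (by rw [image_id]; exact volume_carlesonHull_ne_zero hp)
    (by rw [image_id]; exact ne_top_of_le_ne_top (by finiteness) h1)
  rw [image_id] at h2
  rw [h.conformal.volume_image (measurableSet_carlesonHull α p) (carlesonHull_subset_ball α p)]
  exact h2.trans (by gcongr)

theorem invDerivSup_ne_top (h : IsB1Setting ψ Ω σ) (hp : p.2 < 2 ^ p.1) :
    invDerivSup ψ α p ≠ ∞ := by
  intro h0
  have h1 := h.volume_image_mul_invDerivSup_le (α := α) hp
  rw [h0, ENNReal.mul_top (h.volume_image_ne_zero (measurableSet_carlesonHull α p)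
    (carlesonHull_subset_ball α p) (volume_carlesonHull_ne_zero hp)), top_le_iff] at h1
  exact ENNReal.mul_ne_top h.deriv_lt_top.ne (by finiteness) h1

theorem weightMeasure_mul_invWeightSup_le (h : IsB1Setting ψ Ω σ) (hp : p.2 < 2 ^ p.1) :
    weightMeasure Ω σ (ψ '' carlesonHull α p) * invWeightSup ψ σ α p ≤
      b1Char ψ σ * volume (ψ '' carlesonHull α p) := by
  have hsub := carlesonHull_subset_ball α p
  rw [weightMeasure_apply (h.conformal.measurableSet_image (measurableSet_carlesonHull α p) hsub)
    (h.conformal.image_subset hsub)]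
  exact lintegral_mul_eLpNorm_inv_le_b1Char σ _ (inv_two_pow_pos_and_le_one p.1)
    (h.volume_image_ne_zero (measurableSet_carlesonHull α p) hsub (volume_carlesonHull_ne_zero hp))
    (h.volume_image_ne_top hsub)

theorem invWeightSup_ne_top (h : IsB1Setting ψ Ω σ) (hp : p.2 < 2 ^ p.1) :
    invWeightSup ψ σ α p ≠ ∞ := by
  intro h0
  have h1 := h.weightMeasure_mul_invWeightSup_le (α := α) hp
  have hsub := carlesonHull_subset_ball α p
  have hΩ := h.conformal.image_subset hsub
  have h2 : weightMeasure Ω σ (ψ '' carlesonHull α p) ≠ 0 := by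
    rw [weightMeasure_apply (h.conformal.measurableSet_image (measurableSet_carlesonHull α p) hsub)
      hΩ]
    exact setLIntegral_ofReal_ne_zero
      (h.weight.aestronglyMeasurable.aemeasurable.mono_measure (Measure.restrict_mono hΩ le_rfl))
      (h.weight_pos hΩ) (h.volume_image_ne_zero (measurableSet_carlesonHull α p) hsub
        (volume_carlesonHull_ne_zero hp))
  rw [h0, ENNReal.mul_top h2, top_le_iff] at h1
  exact ENNReal.mul_ne_top h.weight_lt_top.ne (h.volume_image_ne_top hsub) h1

theorem setLIntegral_image_le (h : IsB1Setting ψ Ω σ) (hp : p.2 < 2 ^ p.1) {s : Set ℂ}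
    (hs : s ⊆ carlesonHull α p) (g : ℂ → ℝ≥0∞) :
    ∫⁻ w in ψ '' s, g w ≤ invWeightSup ψ σ α p * ∫⁻ w in ψ '' s, ENNReal.ofReal (σ w) * g w :=
  setLIntegral_le_eLpNorm_inv_mul
    (h.weight_pos (h.conformal.image_subset (hs.trans (carlesonHull_subset_ball α p))))
    (eLpNorm_mono_measure _ (Measure.restrict_mono (image_mono hs) le_rfl))
    (h.invWeightSup_ne_top hp) g

/-- The top half has area comparable to ℓ². Passing to its image costs the supremum of |ψ'|⁻², and
passing from area to σ dA costs that of σ⁻¹. -/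
theorem sq_le_mul_weightMeasure_image_gridTop (h : IsB1Setting ψ Ω σ) (hp : p.2 < 2 ^ p.1) :
    ENNReal.ofReal ((2 : ℝ) ^ p.1)⁻¹ ^ 2 ≤ 100 *
      (invDerivSup ψ α p * (invWeightSup ψ σ α p * weightMeasure Ω σ (ψ '' gridTop α p))) := by
  have hT := gridTop_subset_carlesonHull α p
  have hTb := hT.trans (carlesonHull_subset_ball α p)
  have hTm := measurableSet_gridTop α p
  refine (le_volume_gridTop α hp).trans ?_
  gcongr
  have h1 : volume (gridTop α p) ≤ invDerivSup ψ α p * volume (ψ '' gridTop α p) := by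
    have := setLIntegral_le_eLpNorm_inv_mul (h.deriv_pos hTm hTb)
      (eLpNorm_mono_measure _ (Measure.restrict_mono hT le_rfl)) (h.invDerivSup_ne_top (α := α) hp)
      (fun _ => 1)
    rw [h.conformal.volume_image hTm hTb, invDerivSup]
    simpa only [lintegral_const, Measure.restrict_apply_univ, one_mul, mul_one] using this
  have h2 : volume (ψ '' gridTop α p) ≤
      invWeightSup ψ σ α p * weightMeasure Ω σ (ψ '' gridTop α p) := by
    have := h.setLIntegral_image_le hp hT fun _ => 1
    rw [weightMeasure_apply (h.conformal.measurableSet_image hTm hTb)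
      (h.conformal.image_subset hTb)]
    simpa using this
  exact h1.trans (by gcongr)

/-- The area of the image of the hull links the two `B₁` conditions: it bounds one product and
enters the other as a factor. The result serves both for sparseness and for the coefficients of the
dyadic operators. -/
theorem weightMeasure_image_gridBox_mul_le (h : IsB1Setting ψ Ω σ) (hp : p.2 < 2 ^ p.1) :
    weightMeasure Ω σ (ψ '' gridBox α p) * (invDerivSup ψ α p * invWeightSup ψ σ α p) ≤
      100 * (b1Char ψ σ * b1Char id (fun z => ‖deriv ψ z‖ ^ 2)) *
        ENNReal.ofReal ((2 : ℝ) ^ p.1)⁻¹ ^ 2 := by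
  calc weightMeasure Ω σ (ψ '' gridBox α p) * (invDerivSup ψ α p * invWeightSup ψ σ α p)
      ≤ weightMeasure Ω σ (ψ '' carlesonHull α p) *
          (invDerivSup ψ α p * invWeightSup ψ σ α p) := by
        gcongr
        exact gridBox_subset_carlesonHull α p
    _ = weightMeasure Ω σ (ψ '' carlesonHull α p) * invWeightSup ψ σ α p * invDerivSup ψ α p := by
        ring
    _ ≤ b1Char ψ σ * volume (ψ '' carlesonHull α p) * invDerivSup ψ α p := by
        gcongr ?_ * _; exact h.weightMeasure_mul_invWeightSup_le hp
    _ = b1Char ψ σ * (volume (ψ '' carlesonHull α p) * invDerivSup ψ α p) := by ring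
    _ ≤ b1Char ψ σ * (b1Char id (fun z => ‖deriv ψ z‖ ^ 2) *
          (100 * ENNReal.ofReal ((2 : ℝ) ^ p.1)⁻¹ ^ 2)) := by
        gcongr _ * ?_; exact h.volume_image_mul_invDerivSup_le hp
    _ = _ := by ring

theorem ofReal_inv_two_pow_sq_ne_zero (n : ℕ) : ENNReal.ofReal ((2 : ℝ) ^ n)⁻¹ ^ 2 ≠ 0 :=
  pow_ne_zero 2 (ENNReal.ofReal_pos.2 (inv_two_pow_pos_and_le_one n).1).ne'

theorem weightMeasure_image_gridTop_ne_zero (h : IsB1Setting ψ Ω σ) (hp : p.2 < 2 ^ p.1) :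
    invDerivSup ψ α p ≠ 0 ∧ invWeightSup ψ σ α p ≠ 0 ∧
      weightMeasure Ω σ (ψ '' gridTop α p) ≠ 0 := by
  have h1 := h.sq_le_mul_weightMeasure_image_gridTop (α := α) hp
  have h2 := ofReal_inv_two_pow_sq_ne_zero p.1
  refine ⟨?_, ?_, ?_⟩ <;> intro h0 <;> rw [h0] at h1 <;>
    simp only [zero_mul, mul_zero, nonpos_iff_eq_zero] at h1 <;> exact h2 h1

/-- The measure `σ dA` of a box is controlled by that of its top half. -/
theorem weightMeasure_image_gridBox_le (h : IsB1Setting ψ Ω σ) (α : ℝ) (p : ℕ × ℕ) :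
    weightMeasure Ω σ (ψ '' gridBox α p) ≤
      10000 * (b1Char ψ σ * b1Char id (fun z => ‖deriv ψ z‖ ^ 2)) *
        weightMeasure Ω σ (ψ '' gridTop α p) := by
  rcases le_or_gt (2 ^ p.1) p.2 with hp | hp
  · rw [gridBox_eq_empty hp]; simp
  obtain ⟨h1, h2, -⟩ := h.weightMeasure_image_gridTop_ne_zero (α := α) hp
  refine (ENNReal.mul_le_mul_iff_left (mul_ne_zero h1 h2)
    (ENNReal.mul_ne_top (h.invDerivSup_ne_top hp) (h.invWeightSup_ne_top hp))).1 ?_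
  refine (h.weightMeasure_image_gridBox_mul_le hp).trans ?_
  calc _ ≤ 100 * (b1Char ψ σ * b1Char id (fun z => ‖deriv ψ z‖ ^ 2)) * (100 *
      (invDerivSup ψ α p * (invWeightSup ψ σ α p * weightMeasure Ω σ (ψ '' gridTop α p)))) := by
        gcongr; exact h.sq_le_mul_weightMeasure_image_gridTop hp
    _ = _ := by ring

theorem weightMeasure_univ_ne_top (h : IsB1Setting ψ Ω σ) : weightMeasure Ω σ univ ≠ ∞ := by
  have hp : ((0, 0) : ℕ × ℕ).2 < 2 ^ ((0, 0) : ℕ × ℕ).1 := by simp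
  have h1 := h.weightMeasure_mul_invWeightSup_le (α := 0) hp
  rw [carlesonHull_zero, h.conformal.image_eq] at h1
  have h2 : weightMeasure Ω σ univ = weightMeasure Ω σ Ω := by
    rw [weightMeasure, withDensity_apply _ MeasurableSet.univ,
      withDensity_apply _ Ω.isOpen.measurableSet, Measure.restrict_univ,
      Measure.restrict_restrict Ω.isOpen.measurableSet, inter_self]
  rw [h2]
  intro h0
  rw [h0, ENNReal.top_mul (h.weightMeasure_image_gridTop_ne_zero hp).2.1, top_le_iff] at h1
  exact ENNReal.mul_ne_top h.weight_lt_top.ne h.volume_ne_top h1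

/-- The image of a top half has positive finite measure and lies in that of its box. This allows the
constant 1 in the weak type bound to be absorbed. -/
theorem one_le_mul_b1Char (h : IsB1Setting ψ Ω σ) :
    1 ≤ 10000 * (b1Char ψ σ * b1Char id (fun z => ‖deriv ψ z‖ ^ 2)) := by
  have hp : ((0, 0) : ℕ × ℕ).2 < 2 ^ ((0, 0) : ℕ × ℕ).1 := by simp
  have h1 := h.weightMeasure_image_gridBox_le 0 (0, 0)
  have h2 := (h.weightMeasure_image_gridTop_ne_zero (α := 0) hp).2.2
  have h3 : weightMeasure Ω σ (ψ '' gridTop 0 (0, 0)) ≤ weightMeasure Ω σ (ψ '' gridBox 0 (0, 0)) :=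
    measure_mono (image_mono inter_subset_left)
  have h4 := h3.trans h1
  refine (ENNReal.mul_le_mul_iff_left h2 (ne_top_of_le_ne_top h.weightMeasure_univ_ne_top
    (measure_mono (subset_univ _)))).1 ?_
  rwa [one_mul]

end IsB1Setting

/-! ### Domination of the Bergman projection by dyadic operators -/

/-- The coefficient of a dyadic box in the dyadic majorant of the Bergman kernel. -/
noncomputable def gridCoeff (ψ : ℂ → ℂ) (α : ℝ) (p : ℕ × ℕ) : ℝ≥0∞ :=
  12 * (ENNReal.ofReal ((2 : ℝ) ^ p.1)⁻¹ ^ 2)⁻¹ * invDerivSup ψ α p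

/-- The positive dyadic operator of the grid shifted by `α`, transported to the image of `ψ`. -/
noncomputable def gridOperator (ψ : ℂ → ℂ) (α : ℝ) (f : ℂ → ℂ) (w : ℂ) : ℝ≥0∞ :=
  ∑' p, (ψ '' gridBox α p).indicator
    (fun _ => gridCoeff ψ α p * ∫⁻ y in ψ '' gridBox α p, ‖f y‖ₑ) w

namespace IsB1Setting

variable {ψ : ℂ → ℂ} {Ω : TopologicalSpace.Opens ℂ} {σ : ℂ → ℝ}

theorem enorm_bergmanKernel_le (h : IsB1Setting ψ Ω σ) {α : ℝ} {p : ℕ × ℕ} {z w : ℂ}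
    (hz : z ∈ ball (0 : ℂ) 1) (hw : w ∈ ball (0 : ℂ) 1)
    (hz' : ENNReal.ofReal (‖deriv ψ z‖ ^ 2)⁻¹ ≤ invDerivSup ψ α p)
    (hw' : ENNReal.ofReal (‖deriv ψ w‖ ^ 2)⁻¹ ≤ invDerivSup ψ α p)
    (hp : ((2 : ℝ) ^ p.1)⁻¹ ≤ 6 * ‖1 - z * (starRingEnd ℂ) w‖) :
    ‖bergmanKernel Ω (ψ z) (ψ w)‖ₑ ≤ gridCoeff ψ α p := by
  have hd := h.conformal.deriv_ne_zero h.deriv_lt_top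
  rw [h.conformal.bergmanKernel_eq hd hz hw, ← ofReal_norm, norm_inv, norm_mul, norm_mul, norm_mul,
    norm_pow, RCLike.norm_conj, Complex.norm_real, Real.norm_of_nonneg Real.pi_pos.le]
  set ℓ : ℝ := ((2 : ℝ) ^ p.1)⁻¹
  set d := ‖1 - z * (starRingEnd ℂ) w‖
  have hx : 0 < ‖deriv ψ z‖ := norm_pos_iff.2 (hd z hz)
  have hy : 0 < ‖deriv ψ w‖ := norm_pos_iff.2 (hd w hw)
  set x := ‖deriv ψ z‖
  set y := ‖deriv ψ w‖
  have hℓ : 0 < ℓ := (inv_two_pow_pos_and_le_one p.1).1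
  have h1 : (Real.pi * (x * y * d ^ 2))⁻¹ ≤ 12 * (ℓ ^ 2)⁻¹ * max (x ^ 2)⁻¹ (y ^ 2)⁻¹ := by
    have h2 : (x * y)⁻¹ ≤ max (x ^ 2)⁻¹ (y ^ 2)⁻¹ := by
      rcases le_total x y with hxy | hxy
      · refine le_max_of_le_left (inv_anti₀ (by positivity) ?_)
        nlinarith
      · refine le_max_of_le_right (inv_anti₀ (by positivity) ?_)
        nlinarith
    -- From d ≥ ℓ/6 and π > 3 one gets π d² ≥ ℓ²/12.
    have h3 : (Real.pi * d ^ 2)⁻¹ ≤ 12 * (ℓ ^ 2)⁻¹ := by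
      have h4 : ℓ ^ 2 / 12 ≤ Real.pi * d ^ 2 := by
        have h5 : ℓ ^ 2 ≤ (6 * d) ^ 2 := by gcongr
        nlinarith [Real.pi_gt_three, sq_nonneg d]
      refine (inv_anti₀ (by positivity) h4).trans (le_of_eq ?_)
      rw [inv_div, div_eq_mul_inv]
    calc (Real.pi * (x * y * d ^ 2))⁻¹ = (Real.pi * d ^ 2)⁻¹ * (x * y)⁻¹ := by
          rw [← mul_inv]; congr 1; ring
      _ ≤ _ := by gcongr
  refine (ENNReal.ofReal_le_ofReal h1).trans ?_
  rw [gridCoeff, ENNReal.ofReal_mul (by positivity), ENNReal.ofReal_mul (by norm_num),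
    ENNReal.ofReal_inv_of_pos (by positivity), ENNReal.ofReal_pow hℓ.le, ENNReal.ofReal_ofNat,
    ENNReal.ofReal_max]
  gcongr
  exact max_le hz' hw'

/-- Each box has a null exceptional set, ψ maps null sets to null sets, and there are countably many
boxes. All boxes must be treated at once because the common box depends on both points. -/
theorem ae_le_invDerivSup (h : IsB1Setting ψ Ω σ) (α : ℝ) :
    ∀ᵐ w ∂(volume.restrict (Ω : Set ℂ)), ∀ p, ∀ z ∈ gridBox α p, ψ z = w →
      ENNReal.ofReal (‖deriv ψ z‖ ^ 2)⁻¹ ≤ invDerivSup ψ α p := by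
  rw [ae_all_iff]
  intro p
  set N : Set ℂ := {z ∈ gridBox α p | ¬ ENNReal.ofReal (‖deriv ψ z‖ ^ 2)⁻¹ ≤ invDerivSup ψ α p}
  have hN : volume N = 0 := by
    have h1 := enorm_ae_le_eLpNormEssSup (fun z => (‖deriv ψ z‖ ^ 2)⁻¹)
      (volume.restrict (carlesonHull α p))
    rw [ae_restrict_iff' (measurableSet_carlesonHull α p)] at h1
    rw [ae_iff] at h1
    refine measure_mono_null (fun z hz => ?_) h1
    rw [mem_ofPred_eq]
    intro hcon
    refine hz.2 ?_
    have := hcon (gridBox_subset_carlesonHull α p hz.1)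
    rwa [Real.enorm_eq_ofReal (by positivity), ← eLpNorm_exponent_top] at this
  have hψN : volume (ψ '' N) = 0 := volume_image_eq_zero_of_hasDerivAt
    (fun z hz => h.conformal.hasDerivAt (gridBox_subset_ball α p hz.1)) hN
  refine ae_restrict_of_ae ?_
  refine measure_mono_null (fun w hw => ?_) hψN
  simp only [mem_compl_iff, mem_ofPred_eq, not_forall] at hw
  obtain ⟨z, hz, hzw, hlt⟩ := hw
  exact ⟨z, ⟨hz, hlt⟩, hzw⟩

/-- Tonelli: the dyadic operator is integration against the sum of the product kernels supported on
ψ(Q) × ψ(Q). -/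
theorem lintegral_tsum_indicator_eq_gridOperator (h : IsB1Setting ψ Ω σ) (α : ℝ) {f : ℂ → ℂ}
    (hf : AEMeasurable f (volume.restrict (Ω : Set ℂ))) (w : ℂ) :
    ∫⁻ y in (Ω : Set ℂ), ∑' p, (ψ '' gridBox α p).indicator (fun _ => gridCoeff ψ α p) w *
      (ψ '' gridBox α p).indicator (fun y => ‖f y‖ₑ) y = gridOperator ψ α f w := by
  have hm : ∀ p, MeasurableSet (ψ '' gridBox α p) := fun p =>
    h.conformal.measurableSet_image (measurableSet_gridBox α p) (gridBox_subset_ball α p)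
  have hfm : ∀ p, AEMeasurable ((ψ '' gridBox α p).indicator fun y => ‖f y‖ₑ)
      (volume.restrict (Ω : Set ℂ)) := fun p => hf.enorm.indicator (hm p)
  rw [lintegral_tsum fun p => (hfm p).const_mul _, gridOperator]
  refine tsum_congr fun p => ?_
  rw [lintegral_const_mul'' _ (hfm p), lintegral_indicator (hm p), Measure.restrict_restrict (hm p),
    inter_eq_self_of_subset_left (h.conformal.image_subset (gridBox_subset_ball α p))]
  by_cases hw : w ∈ ψ '' gridBox α p <;> simp [hw]

theorem enorm_bergmanProj_le_gridOperator (h : IsB1Setting ψ Ω σ) {f : ℂ → ℂ}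
    (hf : AEMeasurable f (volume.restrict (Ω : Set ℂ))) :
    ∀ᵐ w ∂(volume.restrict (Ω : Set ℂ)),
      ‖bergmanProj Ω f w‖ₑ ≤ gridOperator ψ 0 f w + gridOperator ψ (1 / 3) f w := by
  -- Used twice: for the point of evaluation and for the variable of integration.
  have hgood := (h.ae_le_invDerivSup 0).and (h.ae_le_invDerivSup (1 / 3))
  filter_upwards [hgood, ae_restrict_mem Ω.isOpen.measurableSet] with ω hω hωΩ
  obtain ⟨z, hz, rfl⟩ := h.conformal.exists_eq hωΩ
  have hm : ∀ α p, MeasurableSet (ψ '' gridBox α p) := fun α p =>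
    h.conformal.measurableSet_image (measurableSet_gridBox α p) (gridBox_subset_ball α p)
  rw [← h.lintegral_tsum_indicator_eq_gridOperator 0 hf,
    ← h.lintegral_tsum_indicator_eq_gridOperator (1 / 3) hf, ← lintegral_add_left']
  · refine (enorm_integral_le_lintegral_enorm _).trans (lintegral_mono_ae ?_)
    filter_upwards [hgood, ae_restrict_mem Ω.isOpen.measurableSet] with η hη hηΩ
    obtain ⟨w, hw, rfl⟩ := h.conformal.exists_eq hηΩ
    rw [enorm_mul]
    obtain ⟨α, hα, p, hzp, hwp, hp⟩ :=
      exists_mem_gridBox (mem_ball_zero_iff.1 hz) (mem_ball_zero_iff.1 hw)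
    have hle : ENNReal.ofReal (‖deriv ψ z‖ ^ 2)⁻¹ ≤ invDerivSup ψ α p ∧
        ENNReal.ofReal (‖deriv ψ w‖ ^ 2)⁻¹ ≤ invDerivSup ψ α p := by
      rcases hα with rfl | rfl
      · exact ⟨hω.1 p z hzp rfl, hη.1 p w hwp rfl⟩
      · exact ⟨hω.2 p z hzp rfl, hη.2 p w hwp rfl⟩
    have hK := h.enorm_bergmanKernel_le hz hw hle.1 hle.2 hp
    have hterm : ‖bergmanKernel Ω (ψ z) (ψ w)‖ₑ * ‖f (ψ w)‖ₑ ≤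
        ∑' q, (ψ '' gridBox α q).indicator (fun _ => gridCoeff ψ α q) (ψ z) *
          (ψ '' gridBox α q).indicator (fun y => ‖f y‖ₑ) (ψ w) := by
      refine le_trans ?_ (ENNReal.le_tsum p)
      rw [indicator_of_mem (mem_image_of_mem ψ hzp), indicator_of_mem (mem_image_of_mem ψ hwp)]
      gcongr
    rcases hα with rfl | rfl
    · exact hterm.trans (le_add_right le_rfl)
    · exact hterm.trans (le_add_left le_rfl)
  · exact AEMeasurable.tsum fun p => ((hf.enorm.indicator (hm 0 p)).const_mul _)

/-! ### From sparse families to the weak type bound for the projection -/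

theorem isNestedFamily_image_gridBox (h : IsB1Setting ψ Ω σ) (α : ℝ) :
    IsNestedFamily Prod.fst fun p => ψ '' gridBox α p :=
  (isNestedFamily_gridBox α).image (gridBox_subset_ball α) h.conformal.injOn fun p =>
    h.conformal.measurableSet_image (measurableSet_gridBox α p) (gridBox_subset_ball α p)

/-- The weak type estimate for the dyadic operators. -/
theorem weightMeasure_one_lt_gridOperator_le (h : IsB1Setting ψ Ω σ) (α : ℝ) (f : ℂ → ℂ) (r : ℝ≥0∞) :
    weightMeasure Ω σ {w | 1 < r * gridOperator ψ α f w} ≤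
      (1 + 4 * (10000 * (b1Char ψ σ * b1Char id (fun z => ‖deriv ψ z‖ ^ 2))) ^ 2) *
        (r * (1200 * (b1Char ψ σ * b1Char id (fun z => ‖deriv ψ z‖ ^ 2))) *
          ∫⁻ w in (Ω : Set ℂ), ENNReal.ofReal (σ w) * ‖f w‖ₑ) := by
  set BU := b1Char ψ σ * b1Char id (fun z => ‖deriv ψ z‖ ^ 2) with hBU
  -- Scaling by `r` reduces every level to level 1. The constant is 1200 = 12 · 100, from the kernel
  -- bound and the area of the hull.
  set lam : Measure ℂ := (r * (1200 * BU)) •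
    (volume.restrict (Ω : Set ℂ)).withDensity fun w => ENNReal.ofReal (σ w) * ‖f w‖ₑ with hlam
  have hTsub : ∀ p, gridTop α p ⊆ ball 0 1 := fun p =>
    inter_subset_left.trans (gridBox_subset_ball α p)
  have ha : ∀ p, r * (gridCoeff ψ α p * ∫⁻ y in ψ '' gridBox α p, ‖f y‖ₑ) *
      weightMeasure Ω σ (ψ '' gridBox α p) ≤ lam (ψ '' gridBox α p) := by
    intro p
    rcases le_or_gt (2 ^ p.1) p.2 with hp | hp
    · rw [gridBox_eq_empty hp]; simp
    have hm := h.conformal.measurableSet_image (measurableSet_gridBox α p) (gridBox_subset_ball α p)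
    have h1 := h.setLIntegral_image_le hp (gridBox_subset_carlesonHull α p) fun y => ‖f y‖ₑ
    have h2 := h.weightMeasure_image_gridBox_mul_le (α := α) hp
    have hs0 := ofReal_inv_two_pow_sq_ne_zero p.1
    rw [hlam, Measure.smul_apply, smul_eq_mul, withDensity_apply _ hm, Measure.restrict_restrict hm,
      inter_eq_self_of_subset_left (h.conformal.image_subset (gridBox_subset_ball α p)), gridCoeff]
    set s := ENNReal.ofReal ((2 : ℝ) ^ p.1)⁻¹ ^ 2
    set L := ∫⁻ y in ψ '' gridBox α p, ENNReal.ofReal (σ y) * ‖f y‖ₑ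
    calc r * (12 * s⁻¹ * invDerivSup ψ α p * ∫⁻ y in ψ '' gridBox α p, ‖f y‖ₑ) *
          weightMeasure Ω σ (ψ '' gridBox α p)
        ≤ r * (12 * s⁻¹ * invDerivSup ψ α p * (invWeightSup ψ σ α p * L)) *
          weightMeasure Ω σ (ψ '' gridBox α p) := by gcongr
      _ = r * 12 * s⁻¹ * L * (weightMeasure Ω σ (ψ '' gridBox α p) *
          (invDerivSup ψ α p * invWeightSup ψ σ α p)) := by ring
      _ ≤ r * 12 * s⁻¹ * L * (100 * BU * s) := by gcongr
      _ = r * (1200 * BU) * L * (s⁻¹ * s) := by ring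
      _ = r * (1200 * BU) * L := by
        rw [ENNReal.inv_mul_cancel hs0 (by finiteness), mul_one]
  have key := (h.isNestedFamily_image_gridBox α).measure_one_lt_tsum_le
    (T := fun p => ψ '' gridTop α p)
    (fun p => h.conformal.measurableSet_image (measurableSet_gridTop α p) (hTsub p))
    (fun p => image_mono inter_subset_left)
    (fun p q hpq => (pairwise_disjoint_gridTop α hpq).image h.conformal.injOn (hTsub p) (hTsub q))
    h.weightMeasure_univ_ne_top (K := 10000 * BU)
    (ENNReal.mul_ne_top (by simp) (ENNReal.mul_ne_top h.weight_lt_top.ne h.deriv_lt_top.ne))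
    (h.weightMeasure_image_gridBox_le α) ha
  rw [hlam, Measure.smul_apply, smul_eq_mul, withDensity_apply _ MeasurableSet.univ,
    Measure.restrict_univ] at key
  refine le_trans (measure_mono fun w hw => ?_) key
  rw [mem_ofPred_eq] at hw ⊢
  refine lt_of_lt_of_eq hw ?_
  rw [gridOperator, ← ENNReal.tsum_mul_left]
  refine tsum_congr fun p => ?_
  by_cases hwp : w ∈ ψ '' gridBox α p <;> simp [hwp]

/-- Positivity of σ almost everywhere; it transfers measurability of f from σ dA to area measure. -/
theorem restrict_absolutelyContinuous_weightMeasure (h : IsB1Setting ψ Ω σ) :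
    volume.restrict (Ω : Set ℂ) ≪ weightMeasure Ω σ := by
  refine withDensity_absolutelyContinuous' h.weight.aestronglyMeasurable.aemeasurable.ennreal_ofReal ?_
  filter_upwards [h.weight.pos] with z hz
  exact (ENNReal.ofReal_pos.2 hz).ne'

theorem eLpNorm_one_weightMeasure (h : IsB1Setting ψ Ω σ) {f : ℂ → ℂ}
    (hf : AEMeasurable f (volume.restrict (Ω : Set ℂ))) :
    eLpNorm f 1 (weightMeasure Ω σ) = ∫⁻ w in (Ω : Set ℂ), ENNReal.ofReal (σ w) * ‖f w‖ₑ := by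
  rw [eLpNorm_one_eq_lintegral_enorm, weightMeasure, lintegral_withDensity_eq_lintegral_mul₀
    h.weight.aestronglyMeasurable.aemeasurable.ennreal_ofReal hf.enorm]
  rfl

theorem weakL1Norm_bergmanProj_le (h : IsB1Setting ψ Ω σ) {f : ℂ → ℂ}
    (hf : AEMeasurable f (volume.restrict (Ω : Set ℂ))) :
    weakL1Norm (bergmanProj Ω f) (weightMeasure Ω σ) ≤
      2400000000000 * b1Char id (fun z => ‖deriv ψ z‖ ^ 2) ^ 3 * b1Char ψ σ ^ 3 *
        eLpNorm f 1 (weightMeasure Ω σ) := by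
  have hK1 := h.one_le_mul_b1Char
  have hweak := h.weightMeasure_one_lt_gridOperator_le
  rw [h.eLpNorm_one_weightMeasure hf]
  set U := b1Char id (fun z => ‖deriv ψ z‖ ^ 2)
  set B := b1Char ψ σ
  set L := ∫⁻ w in (Ω : Set ℂ), ENNReal.ofReal (σ w) * ‖f w‖ₑ
  refine iSup_le fun t => ?_
  rcases eq_or_ne t 0 with rfl | ht
  · simp
  have ht0 : (t : ℝ≥0∞) ≠ 0 := by simpa using ht
  -- If the sum of the two dyadic operators exceeds t, one of them exceeds t/2.
  set r : ℝ≥0∞ := 2 * (t : ℝ≥0∞)⁻¹ with hr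
  set S : ℝ → Set ℂ := fun α => {w | 1 < r * gridOperator ψ α f w}
  have hae := (withDensity_absolutelyContinuous (volume.restrict (Ω : Set ℂ))
    fun z => ENNReal.ofReal (σ z)).ae_le (h.enorm_bergmanProj_le_gridOperator hf)
  have hsub : weightMeasure Ω σ {z | (t : ℝ) < ‖bergmanProj Ω f z‖} ≤
      weightMeasure Ω σ (S 0 ∪ S (1 / 3)) := by
    refine measure_mono_ae ?_
    filter_upwards [hae] with z hz htz
    have htz' : (t : ℝ≥0∞) < ‖bergmanProj Ω f z‖ₑ := by
      rw [← ofReal_norm, ← ENNReal.ofReal_coe_nnreal]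
      exact (ENNReal.ofReal_lt_ofReal_iff_of_nonneg t.2).2 htz
    by_contra hcon
    have hcon' : ¬ (z ∈ S 0 ∪ S (1 / 3)) := hcon
    simp only [S, mem_union, mem_ofPred_eq, not_or, not_lt] at hcon'
    have h1 : 2 * ((t : ℝ≥0∞)⁻¹ * (gridOperator ψ 0 f z + gridOperator ψ (1 / 3) f z)) ≤ 2 * 1 := by
      calc _ = r * gridOperator ψ 0 f z + r * gridOperator ψ (1 / 3) f z := by rw [hr]; ring
        _ ≤ 1 + 1 := add_le_add hcon'.1 hcon'.2
        _ = 2 * 1 := by norm_num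
    have h2 := (ENNReal.mul_le_mul_iff_right two_ne_zero ENNReal.ofNat_ne_top).1 h1
    have h3 : gridOperator ψ 0 f z + gridOperator ψ (1 / 3) f z ≤ t := by
      calc _ = (t : ℝ≥0∞) * ((t : ℝ≥0∞)⁻¹ *
            (gridOperator ψ 0 f z + gridOperator ψ (1 / 3) f z)) := by
            rw [← mul_assoc, ENNReal.mul_inv_cancel ht0 ENNReal.coe_ne_top, one_mul]
        _ ≤ t * 1 := by gcongr
        _ = t := mul_one _
    exact absurd (htz'.trans_le (hz.trans h3)) (lt_irrefl _)
  calc (t : ℝ≥0∞) * weightMeasure Ω σ {z | (t : ℝ) < ‖bergmanProj Ω f z‖}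
      ≤ t * (weightMeasure Ω σ (S 0) + weightMeasure Ω σ (S (1 / 3))) := by
        gcongr
        exact hsub.trans (measure_union_le _ _)
    _ ≤ t * ((1 + 4 * (10000 * (B * U)) ^ 2) * (r * (1200 * (B * U)) * L) +
          (1 + 4 * (10000 * (B * U)) ^ 2) * (r * (1200 * (B * U)) * L)) := by
        gcongr
        · exact hweak 0 f r
        · exact hweak (1 / 3) f r
    _ = (t * (t : ℝ≥0∞)⁻¹) * (4800 * (1 + 4 * (10000 * (B * U)) ^ 2) * ((B * U) * L)) := by
        rw [hr]; ring
    _ = 4800 * (1 + 4 * (10000 * (B * U)) ^ 2) * ((B * U) * L) := by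
        rw [ENNReal.mul_inv_cancel ht0 ENNReal.coe_ne_top, one_mul]
    -- Replacing 1 by K² makes the bound homogeneous of degree three: 4800 · 5 · 10⁸ = 2.4 · 10¹².
    _ ≤ 4800 * ((10000 * (B * U)) ^ 2 + 4 * (10000 * (B * U)) ^ 2) * ((B * U) * L) := by
        gcongr
        exact one_le_pow₀ hK1
    _ = 2400000000000 * U ^ 3 * B ^ 3 * L := by ring

/-! ### Convergence and measurability -/

theorem integrableOn_of_memLp (h : IsB1Setting ψ Ω σ) {f : ℂ → ℂ}
    (hf : MemLp f 1 (weightMeasure Ω σ)) : IntegrableOn f (Ω : Set ℂ) := by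
  have hfm : AEStronglyMeasurable f (volume.restrict (Ω : Set ℂ)) :=
    hf.1.mono_ac h.restrict_absolutelyContinuous_weightMeasure
  have hp : ((0, 0) : ℕ × ℕ).2 < 2 ^ ((0, 0) : ℕ × ℕ).1 := by simp
  have h1 := h.setLIntegral_image_le (α := 0) hp subset_rfl fun y => ‖f y‖ₑ
  rw [carlesonHull_zero, h.conformal.image_eq, ← h.eLpNorm_one_weightMeasure hfm.aemeasurable] at h1
  exact ⟨hfm, h1.trans_lt (ENNReal.mul_lt_top (h.invWeightSup_ne_top hp).lt_top hf.2)⟩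

/-- Read off from the closed form and the continuity of the inverse of ψ. Joint continuity is what
the measurability of the projection requires. -/
theorem continuousOn_bergmanKernel (h : IsB1Setting ψ Ω σ) :
    ContinuousOn (fun p : ℂ × ℂ => bergmanKernel Ω p.1 p.2) ((Ω : Set ℂ) ×ˢ (Ω : Set ℂ)) := by
  have hd := h.conformal.deriv_ne_zero h.deriv_lt_top
  obtain ⟨φ, -, hφ2, hφ⟩ := h.conformal.exists_inverse hd
  have hdd : ContinuousOn (deriv ψ) (ball 0 1) :=
    (h.conformal.differentiableOn.deriv isOpen_ball).continuousOn
  have h1 : ContinuousOn (fun p : ℂ × ℂ => φ p.1) ((Ω : Set ℂ) ×ˢ (Ω : Set ℂ)) :=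
    hφ.continuousOn.comp continuousOn_fst fun p hp => hp.1
  have h2 : ContinuousOn (fun p : ℂ × ℂ => φ p.2) ((Ω : Set ℂ) ×ˢ (Ω : Set ℂ)) :=
    hφ.continuousOn.comp continuousOn_snd fun p hp => hp.2
  have h3 : ContinuousOn (fun p : ℂ × ℂ => deriv ψ (φ p.1)) ((Ω : Set ℂ) ×ˢ (Ω : Set ℂ)) :=
    hdd.comp h1 fun p hp => (hφ2 p.1 hp.1).1
  have h4 : ContinuousOn (fun p : ℂ × ℂ => deriv ψ (φ p.2)) ((Ω : Set ℂ) ×ˢ (Ω : Set ℂ)) :=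
    hdd.comp h2 fun p hp => (hφ2 p.2 hp.2).1
  have hconj : ∀ {g : ℂ × ℂ → ℂ} {s : Set (ℂ × ℂ)}, ContinuousOn g s →
      ContinuousOn (fun p => (starRingEnd ℂ) (g p)) s := fun hg =>
    Complex.continuous_conj.comp_continuousOn hg
  have h5 : ContinuousOn (fun p : ℂ × ℂ => (Real.pi * (deriv ψ (φ p.1) *
      (starRingEnd ℂ) (deriv ψ (φ p.2)) * (1 - φ p.1 * (starRingEnd ℂ) (φ p.2)) ^ 2) : ℂ)⁻¹)
      ((Ω : Set ℂ) ×ˢ (Ω : Set ℂ)) := by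
    refine ContinuousOn.inv₀ (continuousOn_const.mul ((h3.mul (hconj h4)).mul
      ((continuousOn_const.sub (h1.mul (hconj h2))).pow 2))) fun p hp => ?_
    have h6 := one_sub_conj_mul_ne_zero (hφ2 p.2 hp.2).1 (hφ2 p.1 hp.1).1
    rw [mul_comm] at h6
    have hpi : (Real.pi : ℂ) ≠ 0 := by exact_mod_cast Real.pi_ne_zero
    exact mul_ne_zero hpi (mul_ne_zero (mul_ne_zero (hd _ (hφ2 p.1 hp.1).1)
      ((map_ne_zero _).2 (hd _ (hφ2 p.2 hp.2).1))) (pow_ne_zero 2 h6))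
  refine h5.congr fun p hp => ?_
  have h7 := h.conformal.bergmanKernel_eq hd (hφ2 p.1 hp.1).1 (hφ2 p.2 hp.2).1
  rwa [(hφ2 p.1 hp.1).2, (hφ2 p.2 hp.2).2] at h7

/-- For fixed z = ψ(x), combine the lower bound on |ψ'| with |1 - x ȳ| ≥ 1 - |x|. -/
theorem exists_norm_bergmanKernel_le (h : IsB1Setting ψ Ω σ) {z : ℂ} (hz : z ∈ Ω) :
    ∃ C : ℝ, ∀ w ∈ Ω, ‖bergmanKernel Ω z w‖ ≤ C := by
  have hd := h.conformal.deriv_ne_zero h.deriv_lt_top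
  obtain ⟨m, hm, hmle⟩ := h.conformal.exists_pos_le_norm_deriv_sq h.deriv_lt_top
  obtain ⟨x, hx, rfl⟩ := h.conformal.exists_eq hz
  refine ⟨(Real.pi * (Real.sqrt m * Real.sqrt m * (1 - ‖x‖) ^ 2))⁻¹, fun w hw => ?_⟩
  obtain ⟨y, hy, rfl⟩ := h.conformal.exists_eq hw
  rw [h.conformal.bergmanKernel_eq hd hx hy, norm_inv, norm_mul, norm_mul, norm_mul,
    norm_pow, RCLike.norm_conj, Complex.norm_real, Real.norm_of_nonneg Real.pi_pos.le]
  have hx1 : 0 < 1 - ‖x‖ := by rw [mem_ball_zero_iff] at hx; linarith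
  have hm' := Real.sqrt_pos.2 hm
  have hpi := Real.pi_pos
  have h1 : ∀ v ∈ ball (0 : ℂ) 1, Real.sqrt m ≤ ‖deriv ψ v‖ := fun v hv =>
    Real.sqrt_le_iff.2 ⟨norm_nonneg _, hmle v hv⟩
  have h2 := one_sub_norm_le_norm_one_sub_mul_conj (z := x) (mem_ball_zero_iff.1 hy)
  refine inv_anti₀ (by positivity) ?_
  gcongr
  · exact h1 x hx
  · exact h1 y hy

theorem integrableOn_bergmanKernel_mul (h : IsB1Setting ψ Ω σ) {f : ℂ → ℂ}
    (hf : IntegrableOn f (Ω : Set ℂ)) {z : ℂ} (hz : z ∈ Ω) :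
    IntegrableOn (fun w => bergmanKernel Ω z w * f w) (Ω : Set ℂ) := by
  obtain ⟨C, hC⟩ := h.exists_norm_bergmanKernel_le hz
  have hc : ContinuousOn (bergmanKernel Ω z) (Ω : Set ℂ) :=
    h.continuousOn_bergmanKernel.comp (f := fun w => (z, w)) (by fun_prop) fun w hw => ⟨hz, hw⟩
  refine Integrable.bdd_mul hf (c := C) (hc.aestronglyMeasurable Ω.isOpen.measurableSet) ?_
  filter_upwards [ae_restrict_mem Ω.isOpen.measurableSet] with w hw using hC w hw

theorem aestronglyMeasurable_bergmanProj (h : IsB1Setting ψ Ω σ) {f : ℂ → ℂ}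
    (hf : AEStronglyMeasurable f (volume.restrict (Ω : Set ℂ))) :
    AEStronglyMeasurable (bergmanProj Ω f) (volume.restrict (Ω : Set ℂ)) := by
  refine AEStronglyMeasurable.integral_prod_right'
    (f := fun p : ℂ × ℂ => bergmanKernel Ω p.1 p.2 * f p.2) (AEStronglyMeasurable.mul ?_ ?_)
  · rw [Measure.prod_restrict]
    exact h.continuousOn_bergmanKernel.aestronglyMeasurable
      (Ω.isOpen.measurableSet.prod Ω.isOpen.measurableSet)
  · exact hf.comp_snd

end IsB1Setting

/-! ### The weak type theorem -/

theorem theorem1p4 :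
    ∃ (C : ℝ≥0) (N : ℕ), ∀ (Ω : TopologicalSpace.Opens ℂ) (ψ : ℂ → ℂ) (σ : ℂ → ℝ),
      Bornology.IsBounded (Ω : Set ℂ) → SimplyConnectedSpace Ω → IsConformalOnto ψ Ω →
      b1Char id (fun z => ‖deriv ψ z‖ ^ 2) < ∞ →
      IsWeightOn Ω σ → b1Char ψ σ < ∞ →
      ∀ f : ℂ → ℂ, MemLp f 1 (weightMeasure Ω σ) →
        (∀ z ∈ Ω, IntegrableOn (fun w => bergmanKernel Ω z w * f w) (Ω : Set ℂ)) ∧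
        AEStronglyMeasurable (bergmanProj Ω f) (weightMeasure Ω σ) ∧
        weakL1Norm (bergmanProj Ω f) (weightMeasure Ω σ) ≤
          C * b1Char id (fun z => ‖deriv ψ z‖ ^ 2) ^ N * b1Char ψ σ ^ 3 *
            eLpNorm f 1 (weightMeasure Ω σ) := by
  refine ⟨2400000000000, 3, fun Ω ψ σ hb _ hψ hU hσ hB f hf => ?_⟩
  -- Boundedness of Ω enters as finiteness of its area.
  have h : IsB1Setting ψ Ω σ := ⟨hb.measure_lt_top.ne, hψ, hU, hσ, hB⟩
  have hfm : AEStronglyMeasurable f (volume.restrict (Ω : Set ℂ)) :=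
    hf.1.mono_ac h.restrict_absolutelyContinuous_weightMeasure
  refine ⟨fun z hz => h.integrableOn_bergmanKernel_mul (h.integrableOn_of_memLp hf) hz,
    (h.aestronglyMeasurable_bergmanProj hfm).mono_ac (withDensity_absolutelyContinuous _ _), ?_⟩
  exact_mod_cast h.weakL1Norm_bergmanProj_le hfm.aemeasurable
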